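/- Consider a position auction with $n$ agents and $k$ positions, $1\le k<n$, and let $\alpha,\beta\in\mathbb{R}^k$ be vectors with positive, non-increasing entries; put $\alpha_j=\beta_j=0$ for $j>k$. Agents' values $v_1,\dots,v_n$ are drawn independently from a distribution $\mu$ on $\mathbb{R}$ with probability density function $f$, cumulative distribution function $F$ and support $[0,\bar v]$, $0<\bar v<\infty$. In the $\alpha$-VCG mechanism agents submit bids $b_1,\dots,b_n\ge 0$, positions $g_i(b)\in\{1,\dots,n\}$ are assigned one-to-one in non-increasing order of the bids, with ties broken by an arbitrary (measurable) rule depending only on the bids, and agent $i$ pays $p_i(b)=\sum_{j=g_i(b)}^{k}(\alpha_j-\alpha_{j+1})\,b_{(j+1)}$, where $b_{(1)}\ge\dots\ge b_{(n)}$ are the ordered bids. The utility of agent $i$ is $\beta_{g_i(b)}v_i-p_i(b)$. A profile of measurable bidding functions, one for each agent, mapping values to non-negative bids, is an efficient (Bayes-Nash) equilibrium if the resulting allocation maximizes $\sum_i\beta_{g_i}v_i$ for almost every value profile, and for every agent $i$ and almost every value $v_i$ the prescribed bid maximizes the expected utility of agent $i$ over all bids $x\ge 0$, given that the other agents follow their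 bidding functions. For $s\in\{1,\dots,k\}$ let \[ P_s(v)=\binom{n-1}{s-1}(1-F(v))^{s-1}F(v)^{n-s}, \qquad b^V(v)=\frac{\sum_{s=1}^{k}\beta_s\frac{dP_s(v)}{dv}\,v}{\sum_{s=1}^{k}\alpha_s\frac{dP_s(v)}{dv}} . \] Here ``almost every(where)'' refers to the distribution $\mu$ of values, and a function is increasing almost everywhere if it is strictly increasing outside a set of values of probability zero. Then the following hold. (1) In every efficient equilibrium of the $\alpha$-VCG mechanism, every agent uses a bidding function that is equal to $b^V$ almost everywhere. (2) If $b^V$ is increasing almost everywhere, then the symmetric profile in which every agent uses $b^V$ is an efficient equilibrium, and by (1) it is the unique one up to changes on sets of values of probability zero. In this case there moreover is a function equal to $b^V$ almost everywhere which, used by every agent, yields an efficient allocation for every profile of values in $[0,\bar v)$ and an optimal bid for every value in $[0,\bar v)$; if $b^V$ is essentially bounded, the same function does so on all of $[0,\bar v]$. (3) If $b^V$ is not increasing almost everywhere, then no efficient equilibrium exists. (4) If all agents use the same measurable, almost everywhere non-negative bidding function $b$ that is increasing almost everywhere (in particular $b=b^V$ in an efficient equilibrium), then for almost every $v$ each function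 $\frac{dP_s}{dt}\,b$ is integrable on $[0,v]$ and the expected payment of an agent with value $v$ is $\sum_{s=1}^{k}\alpha_s\int_0^v\frac{dP_s(t)}{dt}\,b(t)\,dt$. -/

import Mathlib

open MeasureTheory ProbabilityTheory Set

noncomputable section

namespace PositionAuction

/-- A vector of `k` position qualities, extended by `0` to all later positions.
Positions, like agents, are numbered from `0`. -/
def ext {k : ℕ} (γ : Fin k → ℝ) (j : ℕ) : ℝ :=
  if h : j < k then γ ⟨j, h⟩ else 0

/-- The `j`-th largest entry of `b`, counted from `j = 0`, with value `0` for `j ≥ n`. -/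
def orderStat {n : ℕ} (b : Fin n → ℝ) (j : ℕ) : ℝ :=
  if h : j < n then b (Tuple.sort (fun i => -b i) ⟨j, h⟩) else 0

/-- `g b i` is the position of agent `i` at bid profile `b`. Positions are assigned in
non-increasing order of the bids; ties are broken in an arbitrary (measurable) way that depends on
the bids only. -/
structure IsAllocationRule {n : ℕ} (g : (Fin n → ℝ) → Equiv.Perm (Fin n)) : Prop where
  sorted : ∀ b i j, g b i < g b j → b j ≤ b i
  measurable : ∀ σ, MeasurableSet {b | g b = σ}

/-- The assignment `σ` of agents to positions maximizes welfare at values `v`. -/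
def IsEfficient {n k : ℕ} (β : Fin k → ℝ) (v : Fin n → ℝ) (σ : Equiv.Perm (Fin n)) : Prop :=
  ∀ τ : Equiv.Perm (Fin n), ∑ i, ext β (τ i) * v i ≤ ∑ i, ext β (σ i) * v i

/-- The payment of agent `i` in the VCG mechanism with parameters `α`. -/
def vcgPayment {n k : ℕ} (α : Fin k → ℝ) (g : (Fin n → ℝ) → Equiv.Perm (Fin n))
    (b : Fin n → ℝ) (i : Fin n) : ℝ :=
  ∑ j ∈ Finset.Ico (g b i : ℕ) k, (ext α j - ext α (j + 1)) * orderStat b (j + 1)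

/-- The utility of agent `i` with value `vi` at bid profile `b`. -/
def utility {n k : ℕ} (α β : Fin k → ℝ) (g : (Fin n → ℝ) → Equiv.Perm (Fin n))
    (b : Fin n → ℝ) (i : Fin n) (vi : ℝ) : ℝ :=
  ext β (g b i) * vi - vcgPayment α g b i

/-- The profile of bids when agent `i` bids `x` and every other agent `j` has value `w j` and uses
the bidding function `b j`. -/
def bids {n : ℕ} (b : Fin n → ℝ → ℝ) (i : Fin n) (x : ℝ) (w : Fin n → ℝ) : Fin n → ℝ :=
  Function.update (fun j => b j (w j)) i x

/-- The expected payment of agent `i` when it bids `x`. The values of the other agents are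
independent with law `μ`; the coordinate `i` of `w` is not used. -/
def expectedPayment {n k : ℕ} (μ : Measure ℝ) (α : Fin k → ℝ)
    (g : (Fin n → ℝ) → Equiv.Perm (Fin n)) (b : Fin n → ℝ → ℝ) (i : Fin n) (x : ℝ) : ℝ :=
  ∫ w, vcgPayment α g (bids b i x w) i ∂(Measure.pi fun _ : Fin n => μ)

/-- The expected utility of agent `i` with value `vi` when it bids `x`. -/
def expectedUtility {n k : ℕ} (μ : Measure ℝ) (α β : Fin k → ℝ)
    (g : (Fin n → ℝ) → Equiv.Perm (Fin n)) (b : Fin n → ℝ → ℝ) (i : Fin n) (x vi : ℝ) : ℝ :=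
  ∫ w, utility α β g (bids b i x w) i vi ∂(Measure.pi fun _ : Fin n => μ)

/-- The (not necessarily symmetric) profile `b` of bidding functions, with non-negative bids, is an
efficient Bayes-Nash equilibrium: the allocation is efficient for almost every value profile, and
for almost every value of every agent the bid is optimal. -/
structure IsEfficientEquilibrium {n k : ℕ} (μ : Measure ℝ) (α β : Fin k → ℝ)
    (g : (Fin n → ℝ) → Equiv.Perm (Fin n)) (b : Fin n → ℝ → ℝ) : Prop where
  measurable : ∀ i, Measurable (b i)
  nonneg : ∀ i, ∀ᵐ v ∂μ, 0 ≤ b i v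
  efficient : ∀ᵐ v ∂(Measure.pi fun _ : Fin n => μ), IsEfficient β v (g fun i => b i (v i))
  best_response : ∀ i, ∀ᵐ v ∂μ, ∀ x, 0 ≤ x →
    expectedUtility μ α β g b i x v ≤ expectedUtility μ α β g b i (b i v) v

/-- The symmetric profile given by `b` is an efficient Bayes-Nash equilibrium without exceptional
values in `T`: the allocation is efficient for every profile of values in `T`, and the bid is
optimal for every value in `T`. -/
structure IsEfficientEquilibriumOn {n k : ℕ} (T : Set ℝ) (μ : Measure ℝ) (α β : Fin k → ℝ)
    (g : (Fin n → ℝ) → Equiv.Perm (Fin n)) (b : ℝ → ℝ) : Prop where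
  measurable : Measurable b
  nonneg : ∀ v ∈ T, 0 ≤ b v
  efficient : ∀ v : Fin n → ℝ, (∀ i, v i ∈ T) → IsEfficient β v (g fun i => b (v i))
  best_response : ∀ i : Fin n, ∀ v ∈ T, ∀ x, 0 ≤ x →
    expectedUtility μ α β g (fun _ => b) i x v ≤ expectedUtility μ α β g (fun _ => b) i (b v) v

/-- `b` is (strictly) increasing outside a set of values of probability zero. -/
def IncreasingAE (μ : Measure ℝ) (b : ℝ → ℝ) : Prop :=
  ∃ N : Set ℝ, μ N = 0 ∧ StrictMonoOn b Nᶜ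

/-- The probability that exactly `s` of `n - 1` independent values exceed `v`, i.e. that an agent
with value `v` is assigned position `s` (counted from `0`) in an efficient allocation. -/
def posProb (μ : Measure ℝ) (n s : ℕ) (v : ℝ) : ℝ :=
  ((n - 1).choose s : ℝ) * (1 - cdf μ v) ^ s * (cdf μ v) ^ (n - 1 - s)

/-- The candidate bidding function. -/
def candidateBid {k : ℕ} (μ : Measure ℝ) (n : ℕ) (α β : Fin k → ℝ) (v : ℝ) : ℝ :=
  (∑ s : Fin k, β s * deriv (posProb μ n s) v * v) / (∑ s : Fin k, α s * deriv (posProb μ n s) v)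

end PositionAuction

end

noncomputable section

namespace PositionAuction

/-! Write `F` for `cdf μ`, `w_j` for `orderWeight n j` (the density of the `j`-th largest of `n - 1`
uniform variables) and `M_γ(u) = ∑ j, (γ_j - γ_{j+1}) w_j(u)` for `marginal`. Summation by parts
gives `∑ s, γ_s P_s' = M_γ(F) f` almost everywhere, so the density cancels in the candidate bid,
which becomes `quantileBid`, that is `v M_β(F v) / M_α(F v)`: a function that is positive and
continuous on `(0, vbar)` although `f` need not be continuous (`candidateBid_ae_eq`).

If the others use an increasing `b`, an agent who outbids exactly the values below `t` has interim
utility `∫_{y<t} (v M_β(F y) - b(y) M_α(F y)) dμ` (`expectedPayment_and_expectedUtility`). For `b =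
quantileBid` the integrand is `(v - y) M_β(F y)`, which changes sign at `y = v`, so that `t = v` is
optimal (`expectedUtility_le_of_isThreshold`).

Conversely, efficiency forces all agents to bid almost surely by one strictly increasing function
(`exists_conull_strictMonoOn`). The constraints that values `s < t` do not imitate each other then
squeeze `∫_{[s,t)} b M_α(F) dμ` between `s` and `t` times `∫_{[s,t)} M_β(F) dμ`; letting the two
values approach each other yields `b = quantileBid` (`eq_quantileBid_of_incentive`). Hence no
efficient equilibrium exists unless the candidate is increasing. The payment formula is the interim
payment, rewritten as an integral against Lebesgue measure (`integral_mul_marginal_eq`). -/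

/-! ### Ranks and order statistics of a bid profile -/

/-- The number of entries of `c` that exceed the entry at `i`. -/
def rank {n : ℕ} (c : Fin n → ℝ) (i : Fin n) : ℕ :=
  (Finset.univ.filter fun l => c i < c l).card

theorem card_filter_perm_lt {n : ℕ} (σ : Equiv.Perm (Fin n)) (i : Fin n) :
    (Finset.univ.filter fun l => σ l < σ i).card = σ i := by
  have : (Finset.univ.filter fun l => σ l < σ i).map σ.toEmbedding = Finset.Iio (σ i) := by
    ext a
    simp only [Finset.mem_map, Finset.mem_filter, Finset.mem_univ, true_and, Finset.mem_Iio,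
      Equiv.coe_toEmbedding]
    exact ⟨fun ⟨l, hl, h⟩ => h ▸ hl, fun h => ⟨σ.symm a, by simpa using h, by simp⟩⟩
  rw [← Finset.card_map σ.toEmbedding, this, Fin.card_Iio]

/-- Ties among the other agents are harmless: only a bid equal to that of `i` could let tie-breaking
influence the position of `i`. -/
theorem IsAllocationRule.eq_rank {n : ℕ} {g : (Fin n → ℝ) → Equiv.Perm (Fin n)}
    (hg : IsAllocationRule g) {c : Fin n → ℝ} {i : Fin n} (hc : ∀ l, l ≠ i → c l ≠ c i) :
    (g c i : ℕ) = rank c i := by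
  rw [← card_filter_perm_lt (g c) i, rank]
  congr 1
  ext l
  simp only [Finset.mem_filter, Finset.mem_univ, true_and]
  rcases eq_or_ne l i with rfl | hl
  · simp
  · constructor
    · intro h
      exact lt_of_le_of_ne (hg.sorted c l i h) (hc l hl).symm
    · intro h
      by_contra hlt
      have hne : g c l ≠ g c i := fun h => hl ((g c).injective h)
      exact absurd (hg.sorted c i l (lt_of_le_of_ne (not_lt.1 hlt) hne.symm)) (not_le.2 h)

theorem rank_sort {n : ℕ} {c : Fin n → ℝ} (hc : Function.Injective c) (a : Fin n) :
    rank c (Tuple.sort (fun i => -c i) a) = a := by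
  set σ := Tuple.sort (fun i => -c i)
  have hm : Monotone ((fun i => -c i) ∘ σ) := Tuple.monotone_sort _
  have hs : StrictMono ((fun i => -c i) ∘ σ) :=
    hm.strictMono_of_injective ((neg_injective.comp hc).comp σ.injective)
  have h := card_filter_perm_lt σ.symm (σ a)
  rw [Equiv.symm_apply_apply] at h
  rw [← h, rank]
  congr 1
  ext l
  simp only [Finset.mem_filter, Finset.mem_univ, true_and]
  have := hs.lt_iff_lt (a := σ.symm l) (b := a)
  simp only [Function.comp_apply, Equiv.apply_symm_apply, neg_lt_neg_iff] at this
  exact this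

theorem rank_lt_rank {n : ℕ} {c : Fin n → ℝ} {i l : Fin n} (h : c l < c i) :
    rank c i < rank c l := by
  apply Finset.card_lt_card
  refine (Finset.ssubset_iff_of_subset ?_).2 ⟨i, by simpa using h, by simp⟩
  intro m
  simp only [Finset.mem_filter, Finset.mem_univ, true_and]
  exact fun h' => h.trans h'

theorem rank_lt_rank_iff {n : ℕ} {c : Fin n → ℝ} {i l : Fin n} :
    rank c i < rank c l ↔ c l < c i := by
  refine ⟨fun h => ?_, rank_lt_rank⟩
  by_contra hle
  rcases (not_lt.1 hle).lt_or_eq with h' | h'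
  · exact absurd (rank_lt_rank h') (by omega)
  · simp [rank, h'] at h

theorem rank_injective {n : ℕ} {c : Fin n → ℝ} (hc : Function.Injective c) :
    Function.Injective (rank c) := by
  intro i l h
  rcases lt_trichotomy (c i) (c l) with h' | h' | h'
  · exact absurd (rank_lt_rank h') (by omega)
  · exact hc h'
  · exact absurd (rank_lt_rank h') (by omega)

/-- Among the agents with a lower bid than agent `i`, exactly one has rank `j` among the agents
other than `i`, provided that at most `j` agents bid more than `i`. -/
theorem sum_rank_eq {n : ℕ} {c : Fin n → ℝ} (hc : Function.Injective c) (i : Fin n) {j : ℕ}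
    (hj : j + 1 < n) (h : Fin n → ℝ) :
    (∑ l ∈ Finset.univ.erase i,
      if c l < c i ∧ ((Finset.univ.erase i).filter fun m => c l < c m).card = j then h l else 0) =
    if rank c i ≤ j then h (Tuple.sort (fun i => -c i) ⟨j + 1, hj⟩) else 0 := by
  set L := Tuple.sort (fun i => -c i) ⟨j + 1, hj⟩ with hL
  have hrL : rank c L = j + 1 := rank_sort hc _
  have key : ∀ l, (c l < c i ∧ ((Finset.univ.erase i).filter fun m => c l < c m).card = j) ↔
      (l = L ∧ rank c i ≤ j) := by
    intro l
    -- Agent `i` itself bids more than `l`, so leaving it out lowers the count by one: rank `j`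
    -- among the others is rank `j + 1` among all.
    have hcard : c l < c i →
        ((Finset.univ.erase i).filter fun m => c l < c m).card + 1 = rank c l := by
      intro hl
      have : (Finset.univ.erase i).filter (fun m => c l < c m) =
          (Finset.univ.filter fun m => c l < c m).erase i := by
        ext m; simp [and_comm]
      rw [this, rank, Finset.card_erase_add_one]
      simpa using hl
    constructor
    · rintro ⟨hl, hcd⟩
      have h1 := hcard hl
      have h2 := rank_lt_rank hl
      exact ⟨rank_injective hc (by omega), by omega⟩
    · rintro ⟨rfl, hr⟩
      have hl : c L < c i := rank_lt_rank_iff.1 (by omega)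
      have h1 := hcard hl
      exact ⟨hl, by omega⟩
  simp only [key]
  split_ifs with hr
  · have hLi : L ≠ i := by rintro rfl; omega
    simp [hr, hLi]
  · simp [hr]

theorem orderStat_eq {n : ℕ} (c : Fin n → ℝ) {j : ℕ} (hj : j < n) :
    orderStat c j = c (Tuple.sort (fun i => -c i) ⟨j, hj⟩) := by
  simp [orderStat, hj]

/-! ### Payment and allocation as sums over opponents -/

theorem sum_Ico_ext_sub {k : ℕ} (γ : Fin k → ℝ) (a : ℕ) :
    ∑ j ∈ Finset.Ico a k, (ext γ j - ext γ (j + 1)) = ext γ a := by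
  rcases le_or_gt a k with h | h
  · rw [← neg_inj, ← Finset.sum_neg_distrib]
    simp only [neg_sub]
    rw [Finset.sum_Ico_sub _ h]
    simp [ext]
  · rw [Finset.Ico_eq_empty (by omega)]
    simp [ext]; omega

theorem sum_Ico_eq_sum_range_ite (a k : ℕ) (φ : ℕ → ℝ) :
    ∑ j ∈ Finset.Ico a k, φ j = ∑ j ∈ Finset.range k, if a ≤ j then φ j else 0 := by
  rw [← Finset.sum_filter]
  congr 1
  ext j
  simp [and_comm]

/-- Replaces the sorted bids by indicators attached to single opponents, whose expectations can be
computed one coordinate at a time. -/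
theorem vcgPayment_eq_sum {n k : ℕ} (hkn : k < n) (α : Fin k → ℝ)
    {g : (Fin n → ℝ) → Equiv.Perm (Fin n)} (hg : IsAllocationRule g) {c : Fin n → ℝ}
    (hc : Function.Injective c) (i : Fin n) :
    vcgPayment α g c i = ∑ j ∈ Finset.range k, (ext α j - ext α (j + 1)) *
      ∑ l ∈ Finset.univ.erase i,
        if c l < c i ∧ ((Finset.univ.erase i).filter fun m => c l < c m).card = j
          then c l else 0 := by
  rw [vcgPayment, hg.eq_rank fun l hl h => hl (hc h), sum_Ico_eq_sum_range_ite]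
  refine Finset.sum_congr rfl fun j hj => ?_
  have hj' : j + 1 < n := by have := Finset.mem_range.1 hj; omega
  rw [sum_rank_eq hc i hj', orderStat_eq c hj']
  split_ifs <;> simp

/-- After telescoping, this is the payment formula with every bid replaced by `1`; one integral
therefore serves both. -/
theorem ext_allocation_eq_sum {n k : ℕ} (hkn : k < n) (β : Fin k → ℝ)
    {g : (Fin n → ℝ) → Equiv.Perm (Fin n)} (hg : IsAllocationRule g) {c : Fin n → ℝ}
    (hc : Function.Injective c) (i : Fin n) :
    ext β (g c i) = ∑ j ∈ Finset.range k, (ext β j - ext β (j + 1)) *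
      ∑ l ∈ Finset.univ.erase i,
        if c l < c i ∧ ((Finset.univ.erase i).filter fun m => c l < c m).card = j
          then 1 else 0 := by
  rw [hg.eq_rank fun l hl h => hl (hc h), ← sum_Ico_ext_sub, sum_Ico_eq_sum_range_ite]
  refine Finset.sum_congr rfl fun j hj => ?_
  have hj' : j + 1 < n := by have := Finset.mem_range.1 hj; omega
  rw [sum_rank_eq hc i hj' (fun _ => 1)]
  split_ifs <;> simp

/-! ### Laws of ranks and order statistics of independent values -/

theorem measureReal_Iic_eq_cdf (μ : Measure ℝ) [IsProbabilityMeasure μ] (y : ℝ) :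
    μ.real (Iic y) = cdf μ y := (cdf_eq_real μ y).symm

theorem measureReal_Ioi_eq_cdf (μ : Measure ℝ) [IsProbabilityMeasure μ] (y : ℝ) :
    μ.real (Ioi y) = 1 - cdf μ y := by
  rw [← compl_Iic, probReal_compl_eq_one_sub measurableSet_Iic, cdf_eq_real]

/-- The number of coordinates in `S` that exceed `y` is binomially distributed. -/
theorem measureReal_card_filter_lt {ι : Type*} [Fintype ι] [DecidableEq ι] (μ : Measure ℝ)
    [IsProbabilityMeasure μ] (S : Finset ι) (y : ℝ) (j : ℕ) :
    (Measure.pi fun _ : ι => μ).real {w | (S.filter fun m => y < w m).card = j} =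
      (S.card.choose j : ℝ) * (1 - cdf μ y) ^ j * cdf μ y ^ (S.card - j) := by
  -- The event is the disjoint union of these boxes over the `j`-element sets `T` of coordinates
  -- exceeding `y`; coordinates outside `S` stay free.
  let box : Finset ι → Set (ι → ℝ) := fun T =>
    Set.pi univ fun m => if m ∈ T then Ioi y else if m ∈ S then Iic y else univ
  have hbox : ∀ T ⊆ S, ∀ w, w ∈ box T ↔ S.filter (fun m => y < w m) = T := by
    intro T hT w
    simp only [box, mem_univ_pi]
    constructor
    · intro h
      ext m
      have hm := h m
      simp only [Finset.mem_filter]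
      by_cases hmT : m ∈ T
      · simp only [hmT, if_true] at hm
        simp only [hmT, iff_true]
        exact ⟨hT hmT, hm⟩
      · simp only [hmT, if_false] at hm
        simp only [hmT, iff_false, not_and, not_lt]
        intro hmS
        simpa [hmS] using hm
    · rintro rfl m
      by_cases hmS : m ∈ S <;> by_cases hy : y < w m <;> simp [hmS, hy, not_lt.1]
  have hset : {w : ι → ℝ | (S.filter fun m => y < w m).card = j} =
      ⋃ T ∈ S.powersetCard j, box T := by
    ext w
    simp only [mem_ofPred_eq, mem_iUnion, exists_prop, Finset.mem_powersetCard]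
    constructor
    · intro h
      exact ⟨_, ⟨Finset.filter_subset _ _, h⟩, (hbox _ (Finset.filter_subset _ _) w).2 rfl⟩
    · rintro ⟨T, ⟨hTS, hT⟩, hw⟩
      rw [(hbox T hTS w).1 hw, hT]
  have hdisj : PairwiseDisjoint (↑(S.powersetCard j)) box := by
    intro T hT T' hT' hne
    refine Set.disjoint_left.2 fun w hw hw' => hne ?_
    have hT := (Finset.mem_powersetCard.1 (Finset.mem_coe.1 hT)).1
    have hT' := (Finset.mem_powersetCard.1 (Finset.mem_coe.1 hT')).1
    rw [← (hbox T hT w).1 hw, ← (hbox T' hT' w).1 hw']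
  have hmeas : ∀ T ∈ S.powersetCard j, MeasurableSet (box T) := by
    intro T _
    refine MeasurableSet.univ_pi fun m => ?_
    split_ifs
    · exact measurableSet_Ioi
    · exact measurableSet_Iic
    · exact MeasurableSet.univ
  rw [hset, measureReal_biUnion_finset hdisj hmeas]
  have hval : ∀ T ∈ S.powersetCard j, (Measure.pi fun _ : ι => μ).real (box T) =
      (1 - cdf μ y) ^ j * cdf μ y ^ (S.card - j) := by
    intro T hT
    obtain ⟨hTS, hTj⟩ := Finset.mem_powersetCard.1 hT
    rw [measureReal_def, Measure.pi_pi, ENNReal.toReal_prod]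
    have : ∀ m, (μ (if m ∈ T then Ioi y else if m ∈ S then Iic y else univ)).toReal =
        (if m ∈ T then 1 - cdf μ y else 1) * (if m ∈ S \ T then cdf μ y else 1) := by
      intro m
      have h1 := measureReal_Iic_eq_cdf μ y
      have h2 := measureReal_Ioi_eq_cdf μ y
      rw [measureReal_def] at h1 h2
      by_cases hmT : m ∈ T
      · simp [hmT, h2]
      · by_cases hmS : m ∈ S <;> simp [hmT, hmS, h1]
    simp only [this]
    rw [Finset.prod_mul_distrib, Finset.prod_ite_mem, Finset.prod_ite_mem]
    simp only [Finset.univ_inter, Finset.prod_const]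
    rw [hTj, Finset.card_sdiff_of_subset hTS, hTj]
  rw [Finset.sum_congr rfl hval, Finset.sum_const, Finset.card_powersetCard, nsmul_eq_mul,
    mul_assoc]

theorem measurableSet_card_filter_lt {ι : Type*} (S : Finset ι) (j : ℕ) :
    MeasurableSet {p : ℝ × (ι → ℝ) | (S.filter fun m => p.1 < p.2 m).card = j} := by
  have : Measurable fun p : ℝ × (ι → ℝ) => (S.filter fun m => p.1 < p.2 m).card := by
    simp only [Finset.card_filter]
    refine Finset.measurable_sum _ fun m _ => Measurable.ite ?_ measurable_const measurable_const
    exact measurableSet_lt measurable_fst ((measurable_pi_apply m).comp measurable_snd)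
  exact this (measurableSet_singleton j)

/-- Prepares conditioning on coordinate `l`: the remaining coordinates are indexed through
`l.succAbove`, and `l` is never counted. -/
theorem card_filter_succAbove {n : ℕ} (i l : Fin (n + 1)) (p : Fin (n + 1) → Prop)
    [DecidablePred p] (hl : ¬ p l) :
    ((Finset.univ.erase i).filter p).card =
      ((Finset.univ.filter fun m : Fin n => l.succAbove m ≠ i).filter
        fun m => p (l.succAbove m)).card := by
  rw [← Finset.card_map (Fin.succAboveEmb l)]
  congr 1
  ext m
  simp only [Finset.mem_filter, Finset.mem_erase, Finset.mem_univ, and_true, Finset.mem_map,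
    true_and]
  constructor
  · rintro ⟨hm, hp⟩
    obtain ⟨m', rfl⟩ := Fin.exists_succAbove_eq (x := m) (y := l) (by rintro rfl; exact hl hp)
    exact ⟨m', ⟨hm, hp⟩, rfl⟩
  · rintro ⟨m', ⟨hm, hp⟩, rfl⟩
    exact ⟨hm, hp⟩

theorem card_filter_succAbove_ne {n : ℕ} {i l : Fin (n + 1)} (hil : i ≠ l) :
    (Finset.univ.filter fun m : Fin n => l.succAbove m ≠ i).card = n - 1 := by
  obtain ⟨i', rfl⟩ := Fin.exists_succAbove_eq hil
  simp [Finset.filter_ne', Finset.card_erase_of_mem]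

/-- The law of a coordinate on the event that exactly `j` coordinates other than `i` exceed it. -/
theorem integral_rank_eq {n : ℕ} (μ : Measure ℝ) [IsProbabilityMeasure μ] {i l : Fin n}
    (hil : l ≠ i) (j : ℕ) (t : ℝ) {h : ℝ → ℝ} (hh : IntegrableOn h (Iio t) μ) :
    Integrable (fun w : Fin n → ℝ => if w l < t ∧
      ((Finset.univ.erase i).filter fun m => w l < w m).card = j then h (w l) else 0)
      (Measure.pi fun _ : Fin n => μ) ∧
    ∫ w : Fin n → ℝ, (if w l < t ∧
      ((Finset.univ.erase i).filter fun m => w l < w m).card = j then h (w l) else 0)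
      ∂(Measure.pi fun _ : Fin n => μ) =
    ∫ y in Iio t, h y * (((n - 2).choose j : ℝ) * (1 - cdf μ y) ^ j * cdf μ y ^ (n - 2 - j)) ∂μ := by
  obtain ⟨n, rfl⟩ : ∃ n', n = n' + 1 := ⟨n - 1, by have := i.pos; omega⟩
  set S : Finset (Fin n) := Finset.univ.filter fun m : Fin n => l.succAbove m ≠ i with hS
  have hScard : S.card = n + 1 - 2 := by rw [hS, card_filter_succAbove_ne hil.symm]; omega
  set E : Set (ℝ × (Fin n → ℝ)) := {p | (S.filter fun m => p.1 < p.2 m).card = j} with hE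
  have hEm : MeasurableSet E := measurableSet_card_filter_lt S j
  set φ : ℝ × (Fin n → ℝ) → ℝ := E.indicator fun p => (Iio t).indicator h p.1 with hφ
  -- Fubini with coordinate `l` split off: given its value `y`, the count over the agents other than
  -- `i` and `l` is binomial.
  have hmp := measurePreserving_piFinSuccAbove (fun _ : Fin (n + 1) => μ) l
  have hcomp : (fun w : Fin (n + 1) → ℝ => if w l < t ∧
      ((Finset.univ.erase i).filter fun m => w l < w m).card = j then h (w l) else 0) =
      fun w => φ (MeasurableEquiv.piFinSuccAbove (fun _ => ℝ) l w) := by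
    ext w
    rw [card_filter_succAbove i l (fun m => w l < w m) (lt_irrefl _)]
    have hw : MeasurableEquiv.piFinSuccAbove (fun _ => ℝ) l w =
      (w l, fun m => w (l.succAbove m)) := rfl
    rw [hw, hφ]
    simp only [indicator, hE, mem_ofPred_eq, mem_Iio, hS]
    by_cases h1 : w l < t <;> simp [h1]
  have hh' : Integrable ((Iio t).indicator h) μ := hh.integrable_indicator measurableSet_Iio
  have hφi : Integrable φ (μ.prod (Measure.pi fun _ : Fin n => μ)) :=
    (hh'.comp_fst _).indicator hEm
  rw [hcomp]
  refine ⟨hmp.integrable_comp_of_integrable hφi, ?_⟩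
  rw [hmp.integral_comp' φ, integral_prod _ hφi, ← integral_indicator measurableSet_Iio]
  refine integral_congr_ae (Filter.Eventually.of_forall fun y => ?_)
  have hin : ∀ w', φ (y, w') = {w' : Fin n → ℝ | (S.filter fun m => y < w' m).card = j}.indicator
      (fun _ => (Iio t).indicator h y) w' := fun _ => rfl
  have hm : MeasurableSet {w' : Fin n → ℝ | (S.filter fun m => y < w' m).card = j} :=
    hEm.preimage measurable_prodMk_left
  simp only [hin]
  rw [integral_indicator_const _ hm, measureReal_card_filter_lt, hScard]
  by_cases hy : y ∈ Iio t
  · simp only [indicator_of_mem hy, smul_eq_mul]; ring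
  · simp [indicator_of_notMem hy]

/-! ### Marginal position quality in quantile space -/

/-- The density, with respect to the uniform quantile `u`, of the `j`-th largest of `n - 1`
independent values. -/
def orderWeight (n j : ℕ) (u : ℝ) : ℝ :=
  ((n - 1 : ℕ) : ℝ) * (((n - 2).choose j : ℝ) * (1 - u) ^ j * u ^ (n - 2 - j))

/-- The marginal position quality at quantile `u`. -/
def marginal {k : ℕ} (n : ℕ) (γ : Fin k → ℝ) (u : ℝ) : ℝ :=
  ∑ j ∈ Finset.range k, (ext γ j - ext γ (j + 1)) * orderWeight n j u

theorem continuous_orderWeight (n j : ℕ) : Continuous (orderWeight n j) := by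
  unfold orderWeight; fun_prop

theorem continuous_marginal {k : ℕ} (n : ℕ) (γ : Fin k → ℝ) : Continuous (marginal n γ) := by
  unfold marginal
  exact continuous_finsetSum _ fun j _ => continuous_const.mul (continuous_orderWeight n j)

theorem orderWeight_nonneg (n j : ℕ) {u : ℝ} (h0 : 0 ≤ u) (h1 : u ≤ 1) :
    0 ≤ orderWeight n j u := by
  have : 0 ≤ 1 - u := by linarith
  unfold orderWeight; positivity

theorem ext_sub_nonneg {k : ℕ} {γ : Fin k → ℝ} (hγ : Antitone γ) (hγ0 : ∀ j, 0 < γ j) (j : ℕ) :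
    0 ≤ ext γ j - ext γ (j + 1) := by
  unfold ext
  split_ifs with h1 h2 h2
  · exact sub_nonneg.2 (hγ (by simp))
  · simpa using (hγ0 _).le
  · omega
  · simp

theorem marginal_nonneg {k : ℕ} (n : ℕ) {γ : Fin k → ℝ} (hγ : Antitone γ) (hγ0 : ∀ j, 0 < γ j)
    {u : ℝ} (h0 : 0 ≤ u) (h1 : u ≤ 1) : 0 ≤ marginal n γ u :=
  Finset.sum_nonneg fun j _ =>
    mul_nonneg (ext_sub_nonneg hγ hγ0 j) (orderWeight_nonneg n j h0 h1)

/-- The term `j = k - 1` is positive: its difference is the last entry of `γ`, and `k - 1 ≤ n - 2`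
keeps the binomial coefficient nonzero. At `u = 0` or `u = 1` the sum may vanish. -/
theorem marginal_pos {n k : ℕ} (hk : 0 < k) (hkn : k < n) {γ : Fin k → ℝ} (hγ : Antitone γ)
    (hγ0 : ∀ j, 0 < γ j) {u : ℝ} (h0 : 0 < u) (h1 : u < 1) : 0 < marginal n γ u := by
  refine Finset.sum_pos' (fun j _ =>
    mul_nonneg (ext_sub_nonneg hγ hγ0 j) (orderWeight_nonneg n j h0.le h1.le))
    ⟨k - 1, Finset.mem_range.2 (by omega), mul_pos ?_ ?_⟩
  · have h : k - 1 < k := by omega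
    have h' : ¬ (k - 1 + 1 < k) := by omega
    simpa [ext, h, h'] using hγ0 _
  · have hc : 0 < (n - 2).choose (k - 1) := Nat.choose_pos (by omega)
    have hn : 0 < n - 1 := by omega
    have : 0 < 1 - u := by linarith
    unfold orderWeight
    positivity

theorem continuous_cdf (μ : Measure ℝ) [IsProbabilityMeasure μ] [NullSingletonClass μ] :
    Continuous (cdf μ) := by
  refine continuous_iff_continuousAt.2 fun x => ?_
  refine (cdf μ).mono.continuousAt_iff_leftLim_eq_rightLim.2 ?_
  rw [(cdf μ).rightLim_eq]
  have h : (cdf μ).measure {x} = 0 := by rw [measure_cdf]; exact measure_singleton x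
  rw [StieltjesFunction.measure_singleton, ENNReal.ofReal_eq_zero] at h
  exact le_antisymm ((cdf μ).mono.leftLim_le le_rfl) (by linarith)

theorem abs_orderWeight_cdf_le (n j : ℕ) : ∃ C, ∀ (μ : Measure ℝ) (y : ℝ),
    ‖orderWeight n j (cdf μ y)‖ ≤ C := by
  obtain ⟨C, hC⟩ := isCompact_Icc.exists_bound_of_continuousOn
    (continuous_orderWeight n j).continuousOn (s := Icc 0 1)
  exact ⟨C, fun μ y => hC _ ⟨cdf_nonneg μ y, cdf_le_one μ y⟩⟩

theorem integrableOn_mul_orderWeight {μ : Measure ℝ} [IsProbabilityMeasure μ] {s : Set ℝ}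
    {h : ℝ → ℝ} (hh : IntegrableOn h s μ) (n j : ℕ) :
    IntegrableOn (fun y => h y * orderWeight n j (cdf μ y)) s μ := by
  obtain ⟨C, hC⟩ := abs_orderWeight_cdf_le n j
  refine Integrable.mul_bdd (c := C) hh ?_ (Filter.Eventually.of_forall (hC μ))
  exact ((continuous_orderWeight n j).measurable.comp
    (cdf μ).mono.measurable).aestronglyMeasurable

theorem mul_marginal_eq {k : ℕ} (n : ℕ) (γ : Fin k → ℝ) (h u : ℝ) :
    h * marginal n γ u =
      ∑ j ∈ Finset.range k, (ext γ j - ext γ (j + 1)) * (h * orderWeight n j u) := by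
  rw [marginal, Finset.mul_sum]
  exact Finset.sum_congr rfl fun j _ => by ring

theorem integrableOn_mul_marginal {μ : Measure ℝ} [IsProbabilityMeasure μ] {s : Set ℝ}
    {h : ℝ → ℝ} (hh : IntegrableOn h s μ) {k : ℕ} (n : ℕ) (γ : Fin k → ℝ) :
    IntegrableOn (fun y => h y * marginal n γ (cdf μ y)) s μ := by
  simp only [mul_marginal_eq]
  exact integrable_finsetSum _ fun j _ => (integrableOn_mul_orderWeight hh n j).const_mul _

/-- The integral of a sum, over the ranks `j < k`, of a function of the `j`-th largest of the
values of the agents other than `i`, weighted by the differences of `γ`. -/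
theorem integral_sum_rank {n k : ℕ} (μ : Measure ℝ) [IsProbabilityMeasure μ] (γ : Fin k → ℝ)
    (i : Fin n) (t : ℝ) {h : ℝ → ℝ} (hh : IntegrableOn h (Iio t) μ) :
    Integrable (fun w : Fin n → ℝ => ∑ j ∈ Finset.range k, (ext γ j - ext γ (j + 1)) *
      ∑ l ∈ Finset.univ.erase i, if w l < t ∧
        ((Finset.univ.erase i).filter fun m => w l < w m).card = j then h (w l) else 0)
      (Measure.pi fun _ : Fin n => μ) ∧
    ∫ w : Fin n → ℝ, (∑ j ∈ Finset.range k, (ext γ j - ext γ (j + 1)) *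
      ∑ l ∈ Finset.univ.erase i, if w l < t ∧
        ((Finset.univ.erase i).filter fun m => w l < w m).card = j then h (w l) else 0)
      ∂(Measure.pi fun _ : Fin n => μ) = ∫ y in Iio t, h y * marginal n γ (cdf μ y) ∂μ := by
  have hl : ∀ j, ∀ l ∈ Finset.univ.erase i, _ := fun j l hl =>
    integral_rank_eq μ (Finset.ne_of_mem_erase hl) j t hh
  have hj : ∀ j ∈ Finset.range k, Integrable (fun w : Fin n → ℝ => (ext γ j - ext γ (j + 1)) *
      ∑ l ∈ Finset.univ.erase i, if w l < t ∧
        ((Finset.univ.erase i).filter fun m => w l < w m).card = j then h (w l) else 0)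
      (Measure.pi fun _ : Fin n => μ) := fun j _ =>
    (integrable_finsetSum _ fun l hl' => (hl j l hl').1).const_mul _
  refine ⟨integrable_finsetSum _ hj, ?_⟩
  rw [integral_finsetSum _ hj]
  simp only [mul_marginal_eq]
  rw [integral_finsetSum _ fun j _ => (integrableOn_mul_orderWeight hh n j).const_mul _]
  refine Finset.sum_congr rfl fun j _ => ?_
  -- All `n - 1` opponents contribute the same integral; this is the factor `n - 1` in
  -- `orderWeight`.
  rw [integral_const_mul, integral_const_mul, integral_finsetSum _ fun l hl' => (hl j l hl').1,
    Finset.sum_congr rfl fun l hl' => (hl j l hl').2, Finset.sum_const,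
    Finset.card_erase_of_mem (Finset.mem_univ _), Finset.card_univ, Fintype.card_fin, nsmul_eq_mul,
    ← integral_const_mul]
  congr 2
  ext y
  rw [orderWeight]
  ring

/-! ### Interim payment and utility against increasing bids -/

theorem ae_pi_of_ae {n : ℕ} {μ : Measure ℝ} [IsProbabilityMeasure μ] {p : Fin n → ℝ → Prop}
    (h : ∀ l, ∀ᵐ v ∂μ, p l v) : ∀ᵐ w ∂(Measure.pi fun _ : Fin n => μ), ∀ l, p l (w l) :=
  ae_all_iff.2 fun l =>
    (Measure.quasiMeasurePreserving_eval (fun _ : Fin n => μ) l).ae (h l)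

theorem ae_pi_injective {n : ℕ} (μ : Measure ℝ) [IsProbabilityMeasure μ] [NullSingletonClass μ] :
    ∀ᵐ w ∂(Measure.pi fun _ : Fin n => μ), Function.Injective w := by
  have : ∀ a b : Fin n, a ≠ b → ∀ᵐ w ∂(Measure.pi fun _ : Fin n => μ), w a ≠ w b := by
    intro a b hab
    obtain ⟨n, rfl⟩ : ∃ n', n = n' + 1 := ⟨n - 1, by have := a.pos; omega⟩
    obtain ⟨b', rfl⟩ := Fin.exists_succAbove_eq hab.symm
    have hmp := measurePreserving_piFinSuccAbove (fun _ : Fin (n + 1) => μ) a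
    have h : ∀ᵐ p ∂(μ.prod (Measure.pi fun _ : Fin n => μ)), p.1 ≠ p.2 b' := by
      have hm : MeasurableSet {p : ℝ × (Fin n → ℝ) | p.1 ≠ p.2 b'} := by
        have h := (measurableSet_eq_fun (measurable_fst (α := ℝ) (β := Fin n → ℝ))
          ((measurable_pi_apply b').comp measurable_snd)).compl
        convert h using 1
        ext p
        simp
      refine (Measure.ae_prod_iff_ae_ae hm).2 (Filter.Eventually.of_forall fun y => ?_)
      have := Measure.ae_eval_ne (μ := fun _ : Fin n => μ) b' y
      filter_upwards [this] with w hw using hw.symm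
    exact hmp.quasiMeasurePreserving.ae h
  have h2 := ae_all_iff.2 fun a =>
    ae_all_iff.2 fun b => Filter.eventually_imp_distrib_left.2 (this a b)
  filter_upwards [h2] with w hw a b hab
  by_contra hne
  exact hw a b hne hab

/-- The bid `x` separates the bids `b y`, `y ∈ A`, in the same way as the value `t` separates the
values `y ∈ A`. -/
def IsThreshold (A : Set ℝ) (b : ℝ → ℝ) (x t : ℝ) : Prop :=
  ∀ y ∈ A, (y < t → b y < x) ∧ (t < y → x < b y)

theorem isThreshold_of_strictMonoOn {A T : Set ℝ} {b : ℝ → ℝ} (hb : StrictMonoOn b T)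
    (hAT : A ⊆ T) {t : ℝ} (ht : t ∈ T) : IsThreshold A b (b t) t :=
  fun _ hy => ⟨fun h => hb (hAT hy) ht h, fun h => hb ht (hAT hy) h⟩

/-- Below the threshold the bids are bounded by `x`, so `b` may be unbounded near `vbar`. -/
theorem IsThreshold.integrableOn {μ : Measure ℝ} [IsProbabilityMeasure μ] {A : Set ℝ}
    (hA : ∀ᵐ v ∂μ, v ∈ A) {b : ℝ → ℝ} (hbm : Measurable b) (hb0 : ∀ v ∈ A, 0 ≤ b v) {x t : ℝ}
    (ht : IsThreshold A b x t) : IntegrableOn b (Iio t) μ := by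
  refine Integrable.of_bound hbm.aestronglyMeasurable x ?_
  filter_upwards [ae_restrict_of_ae hA, ae_restrict_mem measurableSet_Iio] with y hy hyt
  rw [Real.norm_of_nonneg (hb0 y hy)]
  exact ((ht y hy).1 hyt).le

/-- The interim payment and the interim utility of agent `i` with bid `x`, when the others bid
almost surely according to a common increasing bidding function. -/
theorem expectedPayment_and_expectedUtility {n k : ℕ} (hkn : k < n) (μ : Measure ℝ)
    [IsProbabilityMeasure μ] [NullSingletonClass μ] (α β : Fin k → ℝ)
    {g : (Fin n → ℝ) → Equiv.Perm (Fin n)} (hg : IsAllocationRule g) {A : Set ℝ}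
    (hA : ∀ᵐ v ∂μ, v ∈ A) {b : ℝ → ℝ} (hbm : Measurable b) (hb : StrictMonoOn b A)
    (hb0 : ∀ v ∈ A, 0 ≤ b v) {B : Fin n → ℝ → ℝ} (hB : ∀ l, B l =ᵐ[μ] b) (i : Fin n) {x t : ℝ}
    (ht : IsThreshold A b x t) :
    expectedPayment μ α g B i x = ∫ y in Iio t, b y * marginal n α (cdf μ y) ∂μ ∧
    ∀ v, expectedUtility μ α β g B i x v =
      v * ∫ y in Iio t, marginal n β (cdf μ y) ∂μ -
        ∫ y in Iio t, b y * marginal n α (cdf μ y) ∂μ := by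
  have hbi : IntegrableOn b (Iio t) μ := ht.integrableOn hA hbm hb0
  have h1i : IntegrableOn (fun _ : ℝ => (1 : ℝ)) (Iio t) μ := integrable_const _
  obtain ⟨hPi, hPe⟩ := integral_sum_rank μ α i t hbi
  obtain ⟨hQi, hQe⟩ := integral_sum_rank μ β i t h1i
  have hae : ∀ᵐ w ∂(Measure.pi fun _ : Fin n => μ),
      vcgPayment α g (bids B i x w) i = (∑ j ∈ Finset.range k, (ext α j - ext α (j + 1)) *
        ∑ l ∈ Finset.univ.erase i, if w l < t ∧
          ((Finset.univ.erase i).filter fun m => w l < w m).card = j then b (w l) else 0) ∧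
      ext β (g (bids B i x w) i) = (∑ j ∈ Finset.range k, (ext β j - ext β (j + 1)) *
        ∑ l ∈ Finset.univ.erase i, if w l < t ∧
          ((Finset.univ.erase i).filter fun m => w l < w m).card = j then 1 else 0) := by
    -- A threshold says nothing about the value `t` itself, which has probability zero.
    have hp : ∀ l : Fin n, ∀ᵐ v ∂μ, v ∈ A ∧ v ≠ t ∧ B l v = b v := by
      intro l
      filter_upwards [hA, hB l, ae_iff.2 (by simp : μ {v | ¬ v ≠ t} = 0)] with v h1 h2 h3
      exact ⟨h1, h3, h2⟩
    filter_upwards [ae_pi_of_ae hp, ae_pi_injective μ] with w hw hinj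
    set c := bids B i x w with hc
    have hci : c i = x := by simp [hc, bids]
    have hcl : ∀ l, l ≠ i → c l = b (w l) := by
      intro l hl; simp [hc, bids, hl, (hw l).2.2]
    have hlt : ∀ l, l ≠ i → (c l < c i ↔ w l < t) := by
      intro l hl
      rw [hcl l hl, hci]
      refine ⟨fun h => ?_, fun h => (ht _ (hw l).1).1 h⟩
      by_contra h'
      exact absurd ((ht _ (hw l).1).2 (lt_of_le_of_ne (not_lt.1 h') (hw l).2.1.symm)) h.not_gt
    have hlm : ∀ l, l ≠ i → ∀ m, m ≠ i → (c l < c m ↔ w l < w m) := by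
      intro l hl m hm
      rw [hcl l hl, hcl m hm]
      exact hb.lt_iff_lt (hw l).1 (hw m).1
    have hne : ∀ l, l ≠ i → c l ≠ c i := by
      intro l hl h
      rcases lt_or_gt_of_ne (hw l).2.1 with h' | h'
      · exact absurd ((hlt l hl).2 h') (by rw [h]; exact lt_irrefl _)
      · have := (ht _ (hw l).1).2 h'
        rw [← hcl l hl, ← hci, h] at this
        exact lt_irrefl _ this
    have hcinj : Function.Injective c := by
      intro l m h
      by_cases hl : l = i
      · by_cases hm : m = i
        · rw [hl, hm]
        · exact absurd (by rw [← h, hl]) (hne m hm)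
      · by_cases hm : m = i
        · exact absurd (by rw [h, hm]) (hne l hl)
        · rw [hcl l hl, hcl m hm] at h
          exact hinj (hb.injOn (hw l).1 (hw m).1 h)
    have hif : ∀ h : Fin n → ℝ, ∀ j, (∑ l ∈ Finset.univ.erase i,
        if c l < c i ∧ ((Finset.univ.erase i).filter fun m => c l < c m).card = j
          then h l else 0) = ∑ l ∈ Finset.univ.erase i,
        if w l < t ∧ ((Finset.univ.erase i).filter fun m => w l < w m).card = j
          then h l else 0 := by
      intro h j
      refine Finset.sum_congr rfl fun l hl => ?_
      have hl' := Finset.ne_of_mem_erase hl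
      simp only [hlt l hl',
        Finset.filter_congr fun m hm => hlm l hl' m (Finset.ne_of_mem_erase hm)]
    rw [vcgPayment_eq_sum hkn α hg hcinj i, ext_allocation_eq_sum hkn β hg hcinj i]
    simp only [hif, and_true]
    refine Finset.sum_congr rfl fun j _ => ?_
    congr 1
    refine Finset.sum_congr rfl fun l hl => ?_
    rw [hcl l (Finset.ne_of_mem_erase hl)]
  refine ⟨?_, fun v => ?_⟩
  · rw [expectedPayment, ← hPe]
    exact integral_congr_ae (hae.mono fun w hw => hw.1)
  · simp only [one_mul] at hQe
    rw [expectedUtility, ← hPe, ← hQe, ← integral_const_mul, ← integral_sub (hQi.const_mul v) hPi]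
    refine integral_congr_ae (hae.mono fun w hw => ?_)
    simp only [utility]
    rw [hw.1, hw.2]
    ring

/-! ### Derivatives of the position probabilities and the candidate bid -/

/-- The weight `orderWeight` of the preceding rank. -/
def orderWeightPred (n : ℕ) : ℕ → ℝ → ℝ
  | 0, _ => 0
  | s + 1, u => orderWeight n s u

theorem orderWeight_eq_bernstein (n j : ℕ) (u : ℝ) :
    orderWeight n j u = ((n - 1 : ℕ) : ℝ) * (bernsteinPolynomial ℝ (n - 2) j).eval (1 - u) := by
  simp [orderWeight, bernsteinPolynomial]

theorem posProb_eq_bernstein (μ : Measure ℝ) (n s : ℕ) (v : ℝ) :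
    posProb μ n s v = (bernsteinPolynomial ℝ (n - 1) s).eval (1 - cdf μ v) := by
  simp [posProb, bernsteinPolynomial]

/-- `posProb` is a Bernstein polynomial of degree `n - 1` at `1 - F`. Its derivative is `n - 1`
times the difference of two neighbours of degree `n - 2`; the inner derivative `-d` reverses the
sign. -/
theorem hasDerivAt_posProb {μ : Measure ℝ} {d v : ℝ} (h : HasDerivAt (cdf μ) d v) (n s : ℕ) :
    HasDerivAt (posProb μ n s)
      ((orderWeight n s (cdf μ v) - orderWeightPred n s (cdf μ v)) * d) v := by
  have h1 : HasDerivAt (fun v => 1 - cdf μ v) (-d) v := h.const_sub 1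
  have h2 := ((bernsteinPolynomial ℝ (n - 1) s).hasDerivAt (1 - cdf μ v)).comp v h1
  have h3 : posProb μ n s =
      (fun x => Polynomial.eval x (bernsteinPolynomial ℝ (n - 1) s)) ∘ fun v => 1 - cdf μ v :=
    funext fun v => posProb_eq_bernstein μ n s v
  rw [h3]
  refine h2.congr_deriv ?_
  rw [orderWeight_eq_bernstein]
  cases s with
  | zero =>
    rw [bernsteinPolynomial.derivative_zero, Nat.sub_sub]
    simp [orderWeightPred]
  | succ s =>
    rw [bernsteinPolynomial.derivative_succ, Nat.sub_sub, orderWeightPred,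
      orderWeight_eq_bernstein]
    simp
    ring

/-- Summation by parts. No boundary term survives, since rank `0` has no predecessor and `ext γ k =
0`. -/
theorem sum_mul_orderWeight_sub {k : ℕ} (n : ℕ) (γ : Fin k → ℝ) (u : ℝ) :
    ∑ s : Fin k, γ s * (orderWeight n s u - orderWeightPred n s u) = marginal n γ u := by
  have h1 : ∑ s : Fin k, γ s * (orderWeight n s u - orderWeightPred n s u) =
      ∑ s ∈ Finset.range k, ext γ s * (orderWeight n s u - orderWeightPred n s u) := by
    rw [Finset.sum_range]
    exact Finset.sum_congr rfl fun s _ => by simp [ext]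
  have h2 : ∑ s ∈ Finset.range k, ext γ s * orderWeightPred n s u =
      ∑ s ∈ Finset.range k, ext γ (s + 1) * orderWeight n s u := by
    have ha := Finset.sum_range_succ (fun s => ext γ s * orderWeightPred n s u) k
    have hb := Finset.sum_range_succ' (fun s => ext γ s * orderWeightPred n s u) k
    have hk : ext γ k = 0 := by simp [ext]
    rw [hb, hk] at ha
    simpa [orderWeightPred] using ha.symm
  rw [h1, marginal]
  simp only [mul_sub, sub_mul, Finset.sum_sub_distrib]
  rw [h2]

theorem measurable_candidateBid (μ : Measure ℝ) {k : ℕ} (n : ℕ) (α β : Fin k → ℝ) :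
    Measurable (candidateBid μ n α β) := by
  unfold candidateBid
  refine Measurable.div (Finset.measurable_sum _ fun s _ => ?_)
    (Finset.measurable_sum _ fun s _ => ?_)
  · exact (measurable_const.mul (measurable_deriv _)).mul measurable_id
  · exact measurable_const.mul (measurable_deriv _)

section Density

variable {μ : Measure ℝ} [IsProbabilityMeasure μ] {f : ℝ → ℝ}

theorem integrable_density (hf : Measurable f) (hf0 : ∀ v, 0 ≤ f v)
    (hμf : μ = volume.withDensity fun v => ENNReal.ofReal (f v)) : Integrable f := by
  refine ⟨hf.aestronglyMeasurable, ?_⟩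
  rw [hasFiniteIntegral_iff_ofReal (Filter.Eventually.of_forall hf0)]
  have : μ univ = ∫⁻ v, ENNReal.ofReal (f v) := by
    rw [hμf, withDensity_apply _ MeasurableSet.univ, Measure.restrict_univ]
  rw [← this]
  exact measure_lt_top μ univ

/-- Lebesgue differentiation: `f` is merely integrable, which is why every identity involving
`deriv` holds only almost everywhere. -/
theorem ae_hasDerivAt_cdf (hf : Measurable f) (hf0 : ∀ v, 0 ≤ f v)
    (hμf : μ = volume.withDensity fun v => ENNReal.ofReal (f v)) :
    ∀ᵐ v, HasDerivAt (cdf μ) (f v) v := by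
  have hfi := integrable_density hf hf0 hμf
  have hcdf : ∀ v, cdf μ v = ∫ y in Iic v, f y := by
    intro v
    rw [cdf_eq_real, measureReal_def, hμf, withDensity_apply _ measurableSet_Iic,
      integral_eq_lintegral_of_nonneg_ae (Filter.Eventually.of_forall hf0)
        hf.aestronglyMeasurable]
  have hcdf' : (cdf μ : ℝ → ℝ) = fun v => (∫ y in (0 : ℝ)..v, f y) + cdf μ 0 := by
    ext v
    rw [hcdf v, hcdf 0, ← intervalIntegral.integral_Iic_sub_Iic hfi.integrableOn hfi.integrableOn]
    ring
  filter_upwards [LocallyIntegrable.ae_hasDerivAt_integral hfi.locallyIntegrable] with v hv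
  rw [hcdf']
  exact (hv 0).add_const _

theorem ae_deriv_posProb (hf : Measurable f) (hf0 : ∀ v, 0 ≤ f v)
    (hμf : μ = volume.withDensity fun v => ENNReal.ofReal (f v)) (n : ℕ) :
    ∀ᵐ v, ∀ s, deriv (posProb μ n s) v =
      (orderWeight n s (cdf μ v) - orderWeightPred n s (cdf μ v)) * f v := by
  filter_upwards [ae_hasDerivAt_cdf hf hf0 hμf] with v hv s
  exact (hasDerivAt_posProb hv n s).deriv

/-- The candidate bidding function, up to null sets, as a function of the value and its
quantile. -/
def quantileBid {k : ℕ} (μ : Measure ℝ) (n : ℕ) (α β : Fin k → ℝ) (v : ℝ) : ℝ :=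
  v * (marginal n β (cdf μ v) / marginal n α (cdf μ v))

theorem candidateBid_ae_eq (hf : Measurable f) (hf0 : ∀ v, 0 ≤ f v)
    (hμf : μ = volume.withDensity fun v => ENNReal.ofReal (f v)) {k : ℕ} (n : ℕ)
    (α β : Fin k → ℝ) : candidateBid μ n α β =ᵐ[μ] quantileBid μ n α β := by
  have hfe : Measurable fun v => ENNReal.ofReal (f v) := hf.ennreal_ofReal
  have hd := ae_deriv_posProb hf hf0 hμf n
  have : ∀ᵐ v ∂(volume.withDensity fun v => ENNReal.ofReal (f v)),
      candidateBid μ n α β v = quantileBid μ n α β v := by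
    -- Only points of nonzero density matter, and there `f v` cancels from the fraction.
    rw [ae_withDensity_iff hfe]
    filter_upwards [hd] with v hv hfv
    have hfv' : f v ≠ 0 := by
      intro h; simp [h] at hfv
    have hsum : ∀ γ : Fin k → ℝ, ∑ s : Fin k, γ s * deriv (posProb μ n s) v =
        marginal n γ (cdf μ v) * f v := by
      intro γ
      rw [← sum_mul_orderWeight_sub, Finset.sum_mul]
      exact Finset.sum_congr rfl fun s _ => by rw [hv s, mul_assoc]
    rw [candidateBid, ← Finset.sum_mul, hsum, hsum, mul_right_comm, mul_div_mul_right _ _ hfv',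
      quantileBid]
    ring
  rw [← hμf] at this
  exact this

theorem integral_mul_marginal_eq [NullSingletonClass μ] (hf : Measurable f) (hf0 : ∀ v, 0 ≤ f v)
    (hμf : μ = volume.withDensity fun v => ENNReal.ofReal (f v)) (hpos : ∀ᵐ y ∂μ, 0 < y)
    {b : ℝ → ℝ} {v : ℝ} (hv : 0 ≤ v) (hb : IntegrableOn b (Iio v) μ) {k : ℕ} (n : ℕ)
    (α : Fin k → ℝ) :
    (∀ s : Fin k, IntervalIntegrable (fun t => deriv (posProb μ n s) t * b t) volume 0 v) ∧
    ∫ y in Iio v, b y * marginal n α (cdf μ y) ∂μ =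
      ∑ s : Fin k, α s * ∫ t in (0 : ℝ)..v, deriv (posProb μ n s) t * b t := by
  have hfe : Measurable fun v => ENNReal.ofReal (f v) := hf.ennreal_ofReal
  have hfe' : ∀ s : Set ℝ, ∀ᵐ v ∂(volume.restrict s), ENNReal.ofReal (f v) < ⊤ := fun s =>
    Filter.Eventually.of_forall fun v => ENNReal.ofReal_lt_top
  -- Values are almost surely positive and `{v}` is null, so the half-line matches the domain of the
  -- interval integral.
  have hset : (Iio v : Set ℝ) =ᵐ[μ] Ioc 0 v := by
    filter_upwards [hpos, ae_iff.2 (by simp : μ {y | ¬ y ≠ v} = 0)] with y hy hyv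
    apply propext
    change y ∈ Iio v ↔ y ∈ Ioc 0 v
    exact ⟨fun h => ⟨hy, (mem_Iio.1 h).le⟩, fun h => lt_of_le_of_ne h.2 hyv⟩
  have hrestr : μ.restrict (Iio v) =
      (volume.restrict (Ioc 0 v)).withDensity fun v => ENNReal.ofReal (f v) := by
    rw [Measure.restrict_congr_set hset]
    conv_lhs => rw [hμf]
    rw [restrict_withDensity measurableSet_Ioc]
  have hprd : ∀ s, IntegrableOn (fun y => b y * orderWeightPred n s (cdf μ y)) (Iio v) μ := by
    intro s
    cases s with
    | zero => simp [orderWeightPred, IntegrableOn]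
    | succ s => exact integrableOn_mul_orderWeight hb n s
  have hint : ∀ s, IntegrableOn (fun y => b y *
      (orderWeight n s (cdf μ y) - orderWeightPred n s (cdf μ y))) (Iio v) μ := by
    intro s
    simp only [mul_sub]
    exact (integrableOn_mul_orderWeight hb n s).sub (hprd s)
  have hcongr : ∀ s : ℕ, (fun y => (ENNReal.ofReal (f y)).toReal • (b y *
      (orderWeight n s (cdf μ y) - orderWeightPred n s (cdf μ y)))) =ᵐ[volume.restrict (Ioc 0 v)]
      fun t => deriv (posProb μ n s) t * b t := by
    intro s
    filter_upwards [ae_restrict_of_ae (ae_deriv_posProb hf hf0 hμf n)] with y hy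
    rw [hy s, ENNReal.toReal_ofReal (hf0 y), smul_eq_mul]
    ring
  have hval : ∀ s : ℕ, ∫ y in Iio v, b y *
      (orderWeight n s (cdf μ y) - orderWeightPred n s (cdf μ y)) ∂μ =
      ∫ t in (0 : ℝ)..v, deriv (posProb μ n s) t * b t := by
    intro s
    rw [intervalIntegral.integral_of_le hv, ← integral_congr_ae (hcongr s), hrestr,
      integral_withDensity_eq_integral_toReal_smul hfe (hfe' _)]
  refine ⟨fun s => ?_, ?_⟩
  · rw [intervalIntegrable_iff_integrableOn_Ioc_of_le hv]
    have h := hint s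
    rw [IntegrableOn, hrestr, integrable_withDensity_iff_integrable_smul' hfe (hfe' _)] at h
    exact h.congr (hcongr s)
  · have : ∀ y, b y * marginal n α (cdf μ y) = ∑ s : Fin k, α s * (b y *
        (orderWeight n s (cdf μ y) - orderWeightPred n s (cdf μ y))) := by
      intro y
      rw [← sum_mul_orderWeight_sub, Finset.mul_sum]
      exact Finset.sum_congr rfl fun s _ => by ring
    simp only [this]
    rw [integral_finsetSum _ fun (s : Fin k) _ => (hint (s : ℕ)).const_mul (α s)]
    exact Finset.sum_congr rfl fun s _ => by rw [integral_const_mul, hval]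

end Density

/-! ### Efficiency forces a common increasing bidding function -/

/-- The measure `μ` is concentrated on `(0, vbar)` and charges every open subinterval. -/
structure IsFullOn (μ : Measure ℝ) (vbar : ℝ) : Prop where
  ae_mem : ∀ᵐ v ∂μ, v ∈ Ioo 0 vbar
  pos : ∀ a c, 0 ≤ a → a < c → c ≤ vbar → 0 < μ (Ioo a c)

theorem nullSingletonClass_of_withDensity {μ : Measure ℝ} {φ : ℝ → ENNReal}
    (h : μ = volume.withDensity φ) : NullSingletonClass μ :=
  ⟨fun x => by rw [h]; exact withDensity_absolutelyContinuous _ _ (measure_singleton x)⟩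

theorem isFullOn_of_support {μ : Measure ℝ} [NullSingletonClass μ] {vbar : ℝ}
    (hsupp : μ.support = Icc 0 vbar) : IsFullOn μ vbar where
  ae_mem := by
    have h : ∀ᵐ v ∂μ, v ∈ μ.support := Measure.support_mem_ae
    filter_upwards [h, ae_iff.2 (by simp : μ {y | ¬ y ≠ 0} = 0),
      ae_iff.2 (by simp : μ {y | ¬ y ≠ vbar} = 0)] with v hv h0 h1
    rw [hsupp] at hv
    exact ⟨lt_of_le_of_ne hv.1 h0.symm, lt_of_le_of_ne hv.2 h1⟩
  pos := by
    intro a c ha hac hc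
    have hm : (a + c) / 2 ∈ μ.support := by
      rw [hsupp]; constructor <;> linarith
    exact (Measure.mem_support_iff_forall _).1 hm _
      (Ioo_mem_nhds (by linarith) (by linarith))

theorem IsFullOn.exists_mem {μ : Measure ℝ} {vbar : ℝ} (hμ : IsFullOn μ vbar) {A : Set ℝ}
    (hA : ∀ᵐ v ∂μ, v ∈ A) {a c : ℝ} (ha : 0 ≤ a) (hac : a < c) (hc : c ≤ vbar) :
    ∃ z ∈ A, a < z ∧ z < c := by
  by_contra! h
  refine (hμ.pos a c ha hac hc).ne' (measure_mono_null ?_ (ae_iff.1 hA))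
  intro z hz hzA
  exact absurd (h z hzA hz.1) (not_le.2 hz.2)

theorem IsFullOn.cdf_pos {μ : Measure ℝ} [IsProbabilityMeasure μ] {vbar : ℝ}
    (hμ : IsFullOn μ vbar) {v : ℝ} (hv : v ∈ Ioo 0 vbar) : 0 < cdf μ v := by
  rw [cdf_eq_real, measureReal_def]
  refine ENNReal.toReal_pos (((hμ.pos 0 v le_rfl hv.1 hv.2.le).trans_le
    (measure_mono fun y hy => hy.2.le)).ne') (measure_ne_top _ _)

theorem IsFullOn.cdf_lt_one {μ : Measure ℝ} [IsProbabilityMeasure μ] {vbar : ℝ}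
    (hμ : IsFullOn μ vbar) {v : ℝ} (hv : v ∈ Ioo 0 vbar) : cdf μ v < 1 := by
  have h : 0 < μ.real (Ioi v) :=
    ENNReal.toReal_pos (((hμ.pos v vbar hv.1.le hv.2 le_rfl).trans_le
      (measure_mono fun y hy => hy.1)).ne') (measure_ne_top _ _)
  rw [measureReal_Ioi_eq_cdf] at h
  linarith

/-- The box has positive product measure. This lets almost sure efficiency be tested on value
profiles of a prescribed shape. -/
theorem exists_of_ae_pi {n : ℕ} {μ : Measure ℝ} [IsProbabilityMeasure μ]
    {P : (Fin n → ℝ) → Prop} (hP : ∀ᵐ w ∂(Measure.pi fun _ : Fin n => μ), P w)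
    {S : Fin n → Set ℝ} (hS : ∀ l, 0 < μ (S l)) : ∃ w, (∀ l, w l ∈ S l) ∧ P w := by
  by_contra! h
  have hz : (Measure.pi fun _ : Fin n => μ) (Set.pi univ S) = 0 :=
    measure_mono_null (fun w hw hw' => h w (fun l => hw l (mem_univ l)) hw') (ae_iff.1 hP)
  rw [Measure.pi_pi, Finset.prod_eq_zero_iff] at hz
  obtain ⟨l, -, hl⟩ := hz
  exact (hS l).ne' hl

/-- Swapping `i` and `l` changes welfare by `(ext β (σ l) - ext β (σ i)) * (v i - v l)`. The
conclusion is weak because entries of `β` may coincide. -/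
theorem IsEfficient.ext_le_ext {n k : ℕ} {β : Fin k → ℝ} {v : Fin n → ℝ}
    {σ : Equiv.Perm (Fin n)} (h : IsEfficient β v σ) {i l : Fin n} (hil : v i < v l) :
    ext β (σ i) ≤ ext β (σ l) := by
  have hne : i ≠ l := by rintro rfl; exact lt_irrefl _ hil
  have h1 := h (σ * Equiv.swap i l)
  have h2 : ∑ m, (ext β ((σ * Equiv.swap i l) m) * v m - ext β (σ m) * v m) =
      (ext β (σ l) * v i - ext β (σ i) * v i) + (ext β (σ i) * v l - ext β (σ l) * v l) := by
    rw [Finset.sum_eq_add i l hne]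
    · simp [Equiv.Perm.mul_apply]
    · rintro m - ⟨hi, hl⟩
      simp [Equiv.Perm.mul_apply, Equiv.swap_apply_of_ne_of_ne hi hl]
    · simp
    · simp
  rw [Finset.sum_sub_distrib] at h2
  nlinarith

theorem card_filter_perm_val_lt {n k : ℕ} (hkn : k ≤ n) (σ : Equiv.Perm (Fin n)) :
    (Finset.univ.filter fun m => (σ m : ℕ) < k).card = k := by
  have : (Finset.univ.filter fun m => (σ m : ℕ) < k).map σ.toEmbedding =
      Finset.univ.filter fun a : Fin n => (a : ℕ) < k := by
    ext a
    simp only [Finset.mem_map, Finset.mem_filter, Finset.mem_univ, true_and,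
      Equiv.coe_toEmbedding]
    exact ⟨fun ⟨l, hl, h⟩ => h ▸ hl, fun h => ⟨σ.symm a, by simpa using h, by simp⟩⟩
  rw [← Finset.card_map σ.toEmbedding, this, Fin.card_filter_val_lt]
  omega

theorem ext_pos_iff {k : ℕ} {β : Fin k → ℝ} (hβ0 : ∀ j, 0 < β j) {j : ℕ} :
    0 < ext β j ↔ j < k := by
  by_cases h : j < k <;> simp [ext, h, hβ0]

/-- In an efficient allocation, the `k` agents of an upper set `U` receive the first `k`
positions. -/
theorem IsEfficient.lt_iff_mem {n k : ℕ} (hkn : k ≤ n) {β : Fin k → ℝ} (hβ0 : ∀ j, 0 < β j)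
    {v : Fin n → ℝ} {σ : Equiv.Perm (Fin n)} (h : IsEfficient β v σ) {U : Finset (Fin n)}
    (hU : U.card = k) (hlt : ∀ m ∈ U, ∀ m' ∉ U, v m' < v m) (m : Fin n) :
    (σ m : ℕ) < k ↔ m ∈ U := by
  set T := Finset.univ.filter fun m => (σ m : ℕ) < k with hT
  have hTk : T.card = k := card_filter_perm_val_lt hkn σ
  have hmemT : ∀ m, m ∈ T ↔ (σ m : ℕ) < k := fun m => by simp [hT]
  have hUT : U ⊆ T := by
    intro m hm
    by_contra hmT
    -- A winner outside `U` would have positive quality, while `m` with its higher value has quality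
    -- zero. So all `k` winners would lie in a set of `k - 1` agents.
    have hsub : T ⊆ U.erase m := by
      intro m' hm'
      refine Finset.mem_erase.2 ⟨fun h => hmT (h ▸ hm'), ?_⟩
      by_contra hm'U
      have h1 := h.ext_le_ext (hlt m hm m' hm'U)
      have h2 := (ext_pos_iff hβ0).2 ((hmemT m').1 hm')
      exact hmT ((hmemT m).2 ((ext_pos_iff hβ0).1 (h2.trans_le h1)))
    have := Finset.card_le_card hsub
    have hpos := Finset.card_pos.2 ⟨m, hm⟩
    rw [Finset.card_erase_of_mem hm] at this
    omega
  rw [← hmemT, Finset.eq_of_subset_of_card_le hUT (by omega)]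

section Efficient

variable {n k : ℕ} {μ : Measure ℝ} [IsProbabilityMeasure μ] {vbar : ℝ} {β : Fin k → ℝ}
  {g : (Fin n → ℝ) → Equiv.Perm (Fin n)} {b : Fin n → ℝ → ℝ}

/-- As `β` may be constant, efficiency reliably separates only winners (positions below `k`) from
losers. Placing `k - 1` agents above `s` and the rest below `r` makes `l` the last winner and `i` a
loser, so `l` bids at least as much. -/
theorem exists_bid_le_bid (hk : 0 < k) (hkn : k < n) (hβ0 : ∀ j, 0 < β j) (hμ : IsFullOn μ vbar)
    (hg : IsAllocationRule g)
    (heff : ∀ᵐ v ∂(Measure.pi fun _ : Fin n => μ), IsEfficient β v (g fun i => b i (v i)))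
    {i l : Fin n} (hil : i ≠ l) {r p s : ℝ} (hr0 : 0 < r) (hrp : r < p) (hps : p < s)
    (hs : s < vbar) {X Y : Set ℝ}
    (hX : X ⊆ Ioo r p) (hY : Y ⊆ Ioo p s) (hXμ : 0 < μ X) (hYμ : 0 < μ Y) :
    ∃ x ∈ X, ∃ y ∈ Y, b i x ≤ b l y := by
  obtain ⟨H, hHsub, hHcard⟩ := Finset.exists_subset_card_eq
    (s := (Finset.univ.erase l).erase i) (n := k - 1) (by
      rw [Finset.card_erase_of_mem (Finset.mem_erase.2 ⟨hil, Finset.mem_univ _⟩),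
        Finset.card_erase_of_mem (Finset.mem_univ _), Finset.card_univ, Fintype.card_fin]
      omega)
  have hiH : i ∉ H := fun h => by simpa using hHsub h
  have hlH : l ∉ H := fun h => by simpa using hHsub h
  obtain ⟨w, hw, hwe⟩ := exists_of_ae_pi heff (S := fun m => if m = i then X else if m = l then Y
    else if m ∈ H then Ioo s vbar else Ioo 0 r) (by
      intro m
      split_ifs
      · exact hXμ
      · exact hYμ
      · exact hμ.pos _ _ (by linarith) hs le_rfl
      · exact hμ.pos _ _ le_rfl hr0 (by linarith))
  have hwi : w i ∈ X := by simpa using hw i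
  have hwl : w l ∈ Y := by simpa [hil.symm] using hw l
  refine ⟨w i, hwi, w l, hwl, ?_⟩
  have hU : ∀ m ∈ insert l H, p < w m := by
    intro m hm
    rcases Finset.mem_insert.1 hm with h | hmH
    · exact h ▸ (hY hwl).1
    · have h := hw m
      have h1 : m ≠ i := by rintro rfl; exact hiH hmH
      have h2 : m ≠ l := by rintro rfl; exact hlH hmH
      simp only [h1, h2, hmH, if_true, if_false] at h
      exact hps.trans h.1
  have hU' : ∀ m ∉ insert l H, w m < p := by
    intro m hm
    rw [Finset.mem_insert, not_or] at hm
    by_cases h1 : m = i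
    · subst h1; exact (hX hwi).2
    · have h := hw m
      simp only [h1, hm.1, hm.2, if_false] at h
      exact h.2.trans hrp
  have hiff := hwe.lt_iff_mem hkn.le hβ0 (U := insert l H)
    (by rw [Finset.card_insert_of_notMem hlH]; omega)
    fun m hm m' hm' => (hU' m' hm').trans (hU m hm)
  have hl : (g (fun i => b i (w i)) l : ℕ) < k := (hiff l).2 (Finset.mem_insert_self _ _)
  have hi : ¬ (g (fun i => b i (w i)) i : ℕ) < k := by
    rw [hiff i, Finset.mem_insert, not_or]; exact ⟨hil, hiH⟩
  exact hg.sorted (fun i => b i (w i)) l i (Fin.lt_def.2 (by omega))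

/-- If the allocation is efficient, then lower values of one agent come with weakly lower bids
than higher values of any other agent. -/
theorem exists_conull_interlaced (hk : 0 < k) (hkn : k < n) (hβ0 : ∀ j, 0 < β j)
    (hμ : IsFullOn μ vbar) (hg : IsAllocationRule g)
    (heff : ∀ᵐ v ∂(Measure.pi fun _ : Fin n => μ), IsEfficient β v (g fun i => b i (v i))) :
    ∃ A : Set ℝ, (∀ᵐ v ∂μ, v ∈ A) ∧ A ⊆ Ioo 0 vbar ∧
      ∀ i l, i ≠ l → ∀ x ∈ A, ∀ y ∈ A, x < y → b i x ≤ b l y := by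
  -- Discarding the null sets in these countable families leaves values at which any violation of
  -- the ordering can be separated by rationals, and so occurs on two sets of positive measure.
  let X : Fin n → ℚ × ℚ × ℚ → Set ℝ := fun i q =>
    {x | x ∈ Ioo (q.1 : ℝ) q.2.1 ∧ (q.2.2 : ℝ) < b i x}
  let Y : Fin n → ℚ × ℚ × ℚ → Set ℝ := fun i q =>
    {y | y ∈ Ioo (q.1 : ℝ) q.2.1 ∧ b i y < (q.2.2 : ℝ)}
  have hnull : ∀ Z : Fin n → ℚ × ℚ × ℚ → Set ℝ,
      ∀ᵐ v ∂μ, ∀ i q, μ (Z i q) = 0 → v ∉ Z i q := by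
    intro Z
    refine ae_all_iff.2 fun i => ae_all_iff.2 fun q => ?_
    by_cases h : μ (Z i q) = 0
    · filter_upwards [measure_eq_zero_iff_ae_notMem.1 h] with v hv _ using hv
    · exact Filter.Eventually.of_forall fun v h' => absurd h' h
  refine ⟨{v | v ∈ Ioo 0 vbar ∧ (∀ i q, μ (X i q) = 0 → v ∉ X i q) ∧
    ∀ i q, μ (Y i q) = 0 → v ∉ Y i q}, ?_, fun v hv => hv.1, ?_⟩
  · filter_upwards [hμ.ae_mem, hnull X, hnull Y] with v h1 h2 h3 using ⟨h1, h2, h3⟩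
  · rintro i l hil x ⟨hx, hxX, -⟩ y ⟨hy, -, hyY⟩ hxy
    by_contra! hlt
    obtain ⟨r, hr0, hrx⟩ := exists_rat_btwn hx.1
    obtain ⟨p, hxp, hpy⟩ := exists_rat_btwn hxy
    obtain ⟨s, hys, hsv⟩ := exists_rat_btwn hy.2
    obtain ⟨c, hyc, hcx⟩ := exists_rat_btwn hlt
    have hX : 0 < μ (X i (r, p, c)) :=
      pos_iff_ne_zero.2 fun h => hxX i (r, p, c) h ⟨⟨hrx, hxp⟩, hcx⟩
    have hY : 0 < μ (Y l (p, s, c)) :=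
      pos_iff_ne_zero.2 fun h => hyY l (p, s, c) h ⟨⟨hpy, hys⟩, hyc⟩
    obtain ⟨x', hx', y', hy', hle⟩ := exists_bid_le_bid hk hkn hβ0 hμ hg heff hil (r := r) (p := p)
      (s := s) (by exact_mod_cast hr0) (hrx.trans hxp) (hpy.trans hys) hsv
      (fun _ h => h.1) (fun _ h => h.1) hX hY
    exact absurd (hx'.2.trans_le (hle.trans hy'.2.le)) (lt_irrefl _)

theorem exists_conull_strictMonoOn (hk : 0 < k) (hkn : k < n) (hβ0 : ∀ j, 0 < β j)
    [NullSingletonClass μ] (hμ : IsFullOn μ vbar) (hg : IsAllocationRule g)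
    (heff : ∀ᵐ v ∂(Measure.pi fun _ : Fin n => μ), IsEfficient β v (g fun i => b i (v i))) :
    ∃ A : Set ℝ, (∀ᵐ v ∂μ, v ∈ A) ∧ A ⊆ Ioo 0 vbar ∧ (∀ i, StrictMonoOn (b i) A) ∧
      ∀ i l, b i =ᵐ[μ] b l := by
  obtain ⟨A, hA, hAI, hle⟩ := exists_conull_interlaced hk hkn hβ0 hμ hg heff
  have hother : ∀ i : Fin n, ∃ l, l ≠ i := by
    intro i
    have : Nontrivial (Fin n) := Fin.nontrivial_iff_two_le.2 (by omega)
    exact exists_ne i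
  -- Two values of the same agent are compared through an intermediate value of another agent.
  have hmono : ∀ i, ∀ x ∈ A, ∀ y ∈ A, x < y → b i x ≤ b i y := by
    intro i x hx y hy hxy
    obtain ⟨l, hl⟩ := hother i
    obtain ⟨z, hz, hxz, hzy⟩ := hμ.exists_mem hA (hAI hx).1.le hxy (hAI hy).2.le
    exact (hle i l hl.symm x hx z hz hxz).trans (hle l i hl z hz y hy hzy)
  have hle' : ∀ i l, ∀ x ∈ A, ∀ y ∈ A, x < y → b i x ≤ b l y := by
    intro i l
    rcases eq_or_ne i l with rfl | h
    · exact hmono i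
    · exact hle i l h
  refine ⟨A, hA, hAI, ?_, ?_⟩
  · intro i x hx y hy hxy
    refine lt_of_le_of_ne (hmono i x hx y hy hxy) fun heq => ?_
    have hconst : ∀ l, ∀ z ∈ A, x < z → z < y → b l z = b i x := fun l z hz hxz hzy =>
      le_antisymm ((hle' l i z hz y hy hzy).trans heq.ge) (hle' i l x hx z hz hxz)
    have hn : 0 < n := by omega
    -- If `b i` took equal values at `x` and `y`, all agents would tie for values in between.
    -- Tie-breaking sees only bids, so `σ` is fixed; giving its first agent `l₀` a lower value than
    -- its last agent `l₁` contradicts efficiency.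
    set σ := g fun _ => b i x with hσ
    set l₀ := σ.symm ⟨0, hn⟩ with hl₀
    set l₁ := σ.symm ⟨n - 1, by omega⟩ with hl₁
    have hne : l₁ ≠ l₀ := by
      intro h
      have := congrArg Fin.val (σ.symm.injective h)
      simp at this
      omega
    obtain ⟨w, hw, hwA, hwe⟩ := exists_of_ae_pi ((ae_pi_of_ae fun _ : Fin n => hA).and heff)
      (S := fun m => if m = l₀ then Ioo x ((x + y) / 2) else Ioo ((x + y) / 2) y) (by
        intro m
        have h0 := (hAI hx).1
        have h1 := (hAI hy).2
        split_ifs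
        · exact hμ.pos _ _ h0.le (by linarith) (by linarith)
        · exact hμ.pos _ _ (by linarith) (by linarith) h1.le)
    have hbid : (fun m => b m (w m)) = fun _ => b i x := by
      ext m
      have h := hw m
      refine hconst m (w m) (hwA m) ?_ ?_ <;> by_cases hm : m = l₀ <;>
        simp only [hm, if_true, if_false, mem_Ioo] at h ⊢ <;> linarith [h.1, h.2]
    rw [hbid, ← hσ] at hwe
    have h0 : w l₀ < (x + y) / 2 := by
      have h := hw l₀
      simp only [if_true, mem_Ioo] at h
      exact h.2
    have h1 : (x + y) / 2 < w l₁ := by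
      have h := hw l₁
      simp only [hne, if_false, mem_Ioo] at h
      exact h.1
    have h := hwe.ext_le_ext (h0.trans h1)
    have hp : 0 < ext β (σ l₀) := (ext_pos_iff hβ0).2 (by simpa [hl₀] using hk)
    have := (ext_pos_iff hβ0).1 (hp.trans_le h)
    simp [hl₁] at this
    omega
  -- The intervals `(b i x, b l x)` are pairwise disjoint by `hle'`, so choosing a rational in each
  -- is injective.
  · have hcount : ∀ i l, {x | x ∈ A ∧ b i x < b l x}.Countable := by
      intro i l
      choose! q hq1 hq2 using fun x (hx : x ∈ {x | x ∈ A ∧ b i x < b l x}) =>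
        exists_rat_btwn hx.2
      refine MapsTo.countable_of_injOn (f := q) (t := univ) (fun _ _ => mem_univ _) ?_
        countable_univ
      have hinj : ∀ x ∈ {x | x ∈ A ∧ b i x < b l x}, ∀ y ∈ {x | x ∈ A ∧ b i x < b l x},
          x < y → q x ≠ q y := by
        intro x hx y hy hxy h
        have h1 := hq2 x hx
        have h2 := hq1 y hy
        have h3 := hle' l i x hx.1 y hy.1 hxy
        rw [h] at h1
        linarith
      intro x hx y hy h
      rcases lt_trichotomy x y with h' | h' | h'
      · exact absurd h (hinj x hx y hy h')
      · exact h'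
      · exact absurd h.symm (hinj y hy x hx h')
    intro i l
    filter_upwards [hA, measure_eq_zero_iff_ae_notMem.1 ((hcount i l).measure_zero μ),
      measure_eq_zero_iff_ae_notMem.1 ((hcount l i).measure_zero μ)] with v hv h1 h2
    exact le_antisymm (not_lt.1 fun h => h2 ⟨hv, h⟩) (not_lt.1 fun h => h1 ⟨hv, h⟩)

end Efficient

/-! ### Incentive constraints determine the bid -/

theorem setIntegral_Iio_sub {μ : Measure ℝ} {h : ℝ → ℝ} {v t : ℝ} (hvt : v ≤ t)
    (hh : IntegrableOn h (Iio t) μ) :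
    ∫ y in Iio t, h y ∂μ - ∫ y in Iio v, h y ∂μ = ∫ y in Ico v t, h y ∂μ := by
  rw [← Iio_union_Ico_eq_Iio hvt, setIntegral_union _ measurableSet_Ico
    (hh.mono_set (Iio_subset_Iio hvt)) (hh.mono_set fun y hy => hy.2)]
  · ring
  · exact Set.disjoint_left.2 fun y hy hy' => absurd hy'.1 (not_le.2 hy)

theorem setIntegral_pos_of_pos {μ : Measure ℝ} {h : ℝ → ℝ} {s : Set ℝ} (hs : MeasurableSet s)
    (hμs : 0 < μ s) (hh : IntegrableOn h s μ) (hpos : ∀ y ∈ s, 0 < h y) :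
    0 < ∫ y in s, h y ∂μ := by
  refine (setIntegral_pos_iff_support_of_nonneg_ae ?_ hh).2 (hμs.trans_le (measure_mono ?_))
  · filter_upwards [ae_restrict_mem hs] with y hy using (hpos y hy).le
  · exact fun y hy => ⟨(hpos y hy).ne', hy⟩

theorem exists_forall_near {φ : ℝ × ℝ → ℝ} (hφ : Continuous φ) {v : ℝ} (h : 0 < φ (v, v)) :
    ∃ δ > 0, ∀ t y, |t - v| < δ → |y - v| < δ → 0 < φ (t, y) := by
  obtain ⟨δ, hδ, H⟩ := Metric.eventually_nhds_iff.1 (hφ.continuousAt.eventually (lt_mem_nhds h))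
  exact ⟨δ, hδ, fun t y ht hy => H (by simpa [Prod.dist_eq, Real.dist_eq] using ⟨ht, hy⟩)⟩

section Bid

variable {n k : ℕ} {μ : Measure ℝ} [IsProbabilityMeasure μ] {vbar : ℝ} {α β : Fin k → ℝ}

theorem integrableOn_marginal_cdf (γ : Fin k → ℝ) (s : Set ℝ) :
    IntegrableOn (fun y => marginal n γ (cdf μ y)) s μ := by
  have h := integrableOn_mul_marginal (μ := μ) (s := s) (h := fun _ => 1) (integrable_const _) n γ
  simpa only [one_mul] using h

/-- A bidding function that satisfies the incentive constraints of an efficient equilibrium on a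
conull set equals `quantileBid` there. -/
theorem eq_quantileBid_of_incentive [NullSingletonClass μ] (hk : 0 < k) (hkn : k < n)
    (hα : Antitone α) (hα0 : ∀ j, 0 < α j) (hμ : IsFullOn μ vbar)
    {A : Set ℝ} (hA : ∀ᵐ v ∂μ, v ∈ A) (hAI : A ⊆ Ioo 0 vbar) {b : ℝ → ℝ} (hb : MonotoneOn b A)
    (hbi : ∀ v ∈ A, IntegrableOn b (Iio v) μ)
    (hic : ∀ v ∈ A, ∀ t ∈ A,
      v * ∫ y in Iio t, marginal n β (cdf μ y) ∂μ -
        ∫ y in Iio t, b y * marginal n α (cdf μ y) ∂μ ≤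
      v * ∫ y in Iio v, marginal n β (cdf μ y) ∂μ -
        ∫ y in Iio v, b y * marginal n α (cdf μ y) ∂μ)
    {v : ℝ} (hv : v ∈ A) : b v = quantileBid μ n α β v := by
  have hMα : ∀ y, 0 ≤ marginal n α (cdf μ y) := fun y =>
    marginal_nonneg n hα hα0 (cdf_nonneg μ y) (cdf_le_one μ y)
  have hMv : 0 < marginal n α (cdf μ v) :=
    marginal_pos hk hkn hα hα0 (hμ.cdf_pos (hAI hv)) (hμ.cdf_lt_one (hAI hv))
  -- The lower bound says that value `s` does not gain by imitating `t`, the upper bound that `t`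
  -- does not gain by imitating `s`.
  have hbounds : ∀ s ∈ A, ∀ t ∈ A, s < t →
      s * ∫ y in Ico s t, marginal n β (cdf μ y) ∂μ ≤
        ∫ y in Ico s t, b y * marginal n α (cdf μ y) ∂μ ∧
      ∫ y in Ico s t, b y * marginal n α (cdf μ y) ∂μ ≤
        t * ∫ y in Ico s t, marginal n β (cdf μ y) ∂μ := by
    intro s hs t ht hst
    rw [← setIntegral_Iio_sub hst.le (integrableOn_marginal_cdf β _),
      ← setIntegral_Iio_sub hst.le (integrableOn_mul_marginal (hbi t ht) n α)]
    have h1 := hic s hs t ht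
    have h2 := hic t ht s hs
    constructor <;> linarith
  have hcont : ∀ γ : Fin k → ℝ, Continuous fun y => marginal n γ (cdf μ y) := fun γ =>
    (continuous_marginal n γ).comp (continuous_cdf μ)
  have hφ : Continuous fun p : ℝ × ℝ => b v * marginal n α (cdf μ p.2) -
      p.1 * marginal n β (cdf μ p.2) :=
    (continuous_const.mul ((hcont α).comp continuous_snd)).sub
      (continuous_fst.mul ((hcont β).comp continuous_snd))
  have hint : ∀ s t u w : ℝ, ∫ y in Ico s t, (u * marginal n α (cdf μ y) -
      w * marginal n β (cdf μ y)) ∂μ = u * ∫ y in Ico s t, marginal n α (cdf μ y) ∂μ -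
      w * ∫ y in Ico s t, marginal n β (cdf μ y) ∂μ := by
    intro s t u w
    rw [integral_sub ((integrableOn_marginal_cdf α _).const_mul u)
      ((integrableOn_marginal_cdf β _).const_mul w), integral_const_mul, integral_const_mul]
  have hint' : ∀ s t u w : ℝ, IntegrableOn (fun y => u * marginal n α (cdf μ y) -
      w * marginal n β (cdf μ y)) (Ico s t) μ := fun s t u w =>
    ((integrableOn_marginal_cdf α _).const_mul u).sub
      ((integrableOn_marginal_cdf β _).const_mul w)
  have hmeas : ∀ s ∈ A, ∀ t ∈ A, s < t → 0 < μ (Ico s t) := fun s hs t ht hst =>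
    (hμ.pos s t (hAI hs).1.le hst (hAI ht).2.le).trans_le (measure_mono Ioo_subset_Ico_self)
  rw [quantileBid, ← mul_div_assoc, eq_div_iff hMv.ne']
  refine le_antisymm ?_ ?_
  -- If `b v` is too large, then `b v * M_α > t * M_β` on a short interval `[v, t)` by continuity of
  -- the marginals. There `b ≥ b v` by monotonicity, which replaces continuity of `b`, and the upper
  -- bound fails.
  · by_contra! hlt
    obtain ⟨δ, hδ, H⟩ := exists_forall_near hφ (v := v) (by simpa using hlt)
    obtain ⟨t, ht, hvt, htm⟩ := hμ.exists_mem hA (a := v) (c := min (v + δ) vbar) (hAI hv).1.le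
      (lt_min (by linarith) (hAI hv).2) (min_le_right _ _)
    have htδ : t < v + δ := htm.trans_le (min_le_left _ _)
    have hpos := setIntegral_pos_of_pos measurableSet_Ico (hmeas v hv t ht hvt)
      (hint' v t (b v) t) fun y hy => H t y (abs_lt.2 ⟨by linarith, by linarith⟩)
        (abs_lt.2 ⟨by linarith [hy.1], by linarith [hy.2]⟩)
    rw [hint] at hpos
    have hle : b v * ∫ y in Ico v t, marginal n α (cdf μ y) ∂μ ≤
        ∫ y in Ico v t, b y * marginal n α (cdf μ y) ∂μ := by
      rw [← integral_const_mul]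
      refine integral_mono_ae ((integrableOn_marginal_cdf α _).const_mul _)
        ((integrableOn_mul_marginal (hbi t ht) n α).mono_set fun y hy => hy.2) ?_
      filter_upwards [ae_restrict_of_ae hA, ae_restrict_mem measurableSet_Ico] with y hy hyI
      exact mul_le_mul_of_nonneg_right (hb hv hy hyI.1) (hMα y)
    have := (hbounds v hv t ht hvt).2
    linarith
  -- The mirror image: on `[s, v)` one has `b ≤ b v`, and the lower bound fails.
  · by_contra! hlt
    obtain ⟨δ, hδ, H⟩ := exists_forall_near hφ.neg (v := v) (by simpa using hlt)
    obtain ⟨s, hs, hsm, hsv⟩ := hμ.exists_mem hA (a := max (v - δ) 0) (c := v) (le_max_right _ _)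
      (max_lt (by linarith) (hAI hv).1) (hAI hv).2.le
    have hsδ : v - δ < s := (le_max_left _ _).trans_lt hsm
    have hpos := setIntegral_pos_of_pos measurableSet_Ico (hmeas s hs v hv hsv)
      (hint' s v (b v) s).neg fun y hy => H s y (abs_lt.2 ⟨by linarith, by linarith⟩)
        (abs_lt.2 ⟨by linarith [hy.1], by linarith [hy.2]⟩)
    simp only [Pi.neg_apply] at hpos
    rw [integral_neg, hint] at hpos
    have hle : ∫ y in Ico s v, b y * marginal n α (cdf μ y) ∂μ ≤
        b v * ∫ y in Ico s v, marginal n α (cdf μ y) ∂μ := by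
      rw [← integral_const_mul]
      refine integral_mono_ae
        ((integrableOn_mul_marginal (hbi v hv) n α).mono_set fun y hy => hy.2)
        ((integrableOn_marginal_cdf α _).const_mul _) ?_
      filter_upwards [ae_restrict_of_ae hA, ae_restrict_mem measurableSet_Ico] with y hy hyI
      exact mul_le_mul_of_nonneg_right (hb hy hv hyI.2.le) (hMα y)
    have := (hbounds s hs v hv hsv).1
    linarith

/-- In an efficient equilibrium all bidding functions agree with `quantileBid`, and are strictly
increasing on a common conull set. -/
theorem IsEfficientEquilibrium.ae_eq_quantileBid [NullSingletonClass μ] (hk : 0 < k) (hkn : k < n)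
    (hα : Antitone α) (hα0 : ∀ j, 0 < α j) (hβ0 : ∀ j, 0 < β j) (hμ : IsFullOn μ vbar)
    {g : (Fin n → ℝ) → Equiv.Perm (Fin n)} (hg : IsAllocationRule g) {b : Fin n → ℝ → ℝ}
    (h : IsEfficientEquilibrium μ α β g b) (i : Fin n) :
    b i =ᵐ[μ] quantileBid μ n α β ∧ ∃ A : Set ℝ, (∀ᵐ v ∂μ, v ∈ A) ∧ StrictMonoOn (b i) A := by
  obtain ⟨A, hA, hAI, hmono, heq⟩ := exists_conull_strictMonoOn hk hkn hβ0 hμ hg h.efficient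
  refine ⟨?_, A, hA, hmono i⟩
  set A' : Set ℝ := {v | v ∈ A ∧ 0 ≤ b i v} with hA'
  have hA'm : ∀ᵐ v ∂μ, v ∈ A' := by
    filter_upwards [hA, h.nonneg i] with v h1 h2 using ⟨h1, h2⟩
  have hmono' : StrictMonoOn (b i) A' := (hmono i).mono fun v hv => hv.1
  set T : Set ℝ := {v | v ∈ A' ∧ ∀ x, 0 ≤ x →
    expectedUtility μ α β g b i x v ≤ expectedUtility μ α β g b i (b i v) v} with hT
  have hTm : ∀ᵐ v ∂μ, v ∈ T := by
    filter_upwards [hA'm, h.best_response i] with v h1 h2 using ⟨h1, h2⟩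
  have hthr : ∀ t ∈ T, IsThreshold A' (b i) (b i t) t := fun t ht =>
    isThreshold_of_strictMonoOn hmono' subset_rfl ht.1
  have hEU : ∀ t ∈ T, ∀ v, _ := fun t ht =>
    (expectedPayment_and_expectedUtility hkn μ α β hg hA'm (h.measurable i) hmono'
      (fun v hv => hv.2) (fun l => heq l i) i (hthr t ht)).2
  filter_upwards [hTm] with v hv
  refine eq_quantileBid_of_incentive hk hkn hα hα0 hμ hTm (fun v hv => hAI hv.1.1)
    (hmono'.monotoneOn.mono fun v hv => hv.1)
    (fun v hv => (hthr v hv).integrableOn hA'm (h.measurable i) fun v hv => hv.2) ?_ hv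
  intro v hv t ht
  -- The only deviation needed is to the bid of another value `t`, for which the threshold is `t`
  -- itself.
  have h1 := hv.2 (b i t) ht.1.2
  rwa [hEU t ht v, hEU v hv v] at h1

end Bid

/-! ### Sufficiency: optimality of the candidate bid -/

/-- An allocation in non-increasing order of the values is efficient. -/
theorem isEfficient_of_sorted {n k : ℕ} {β : Fin k → ℝ} (hβ : Antitone β) (hβ0 : ∀ j, 0 < β j)
    {v : Fin n → ℝ} {σ : Equiv.Perm (Fin n)} (h : ∀ i j, σ i < σ j → v j ≤ v i) :
    IsEfficient β v σ := by
  intro τ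
  have hanti : Antitone (ext β) :=
    antitone_nat_of_succ_le fun j => sub_nonneg.1 (ext_sub_nonneg hβ hβ0 j)
  have hm : Monovary (fun i => ext β (σ i)) v := by
    intro i j hij
    refine hanti (Fin.le_def.1 (not_lt.1 fun h' => ?_))
    exact absurd (h i j h') (not_le.2 hij)
  -- Rearrangement inequality; composing `ext β ∘ σ` with this permutation gives `ext β ∘ τ`.
  have := hm.sum_comp_perm_mul_le_sum_mul (σ := τ.trans σ.symm)
  simpa using this

theorem isEfficient_of_strictMonoOn {n k : ℕ} {β : Fin k → ℝ} (hβ : Antitone β)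
    (hβ0 : ∀ j, 0 < β j) {g : (Fin n → ℝ) → Equiv.Perm (Fin n)} (hg : IsAllocationRule g)
    {b : ℝ → ℝ} {T : Set ℝ} (hb : StrictMonoOn b T) {v : Fin n → ℝ} (hv : ∀ i, v i ∈ T) :
    IsEfficient β v (g fun i => b (v i)) :=
  isEfficient_of_sorted hβ hβ0 fun i j h =>
    (hb.le_iff_le (hv j) (hv i)).1 (hg.sorted (fun i => b (v i)) i j h)

/-- A deviation `x` need not be the bid of any value, so the threshold is the supremum of the values
bidding at most `x`. The inserted `0` covers bids below all others. -/
theorem exists_isThreshold {vbar : ℝ} {b : ℝ → ℝ} (hb : StrictMonoOn b (Ioo 0 vbar)) (x : ℝ) :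
    ∃ t, IsThreshold (Ioo 0 vbar) b x t := by
  set S : Set ℝ := insert 0 {y | y ∈ Ioo 0 vbar ∧ b y ≤ x} with hS
  have hbdd : BddAbove S :=
    ⟨max 0 vbar, by
      rintro y (rfl | hy)
      · exact le_max_left _ _
      · exact hy.1.2.le.trans (le_max_right _ _)⟩
  refine ⟨sSup S, fun y hy => ⟨fun h => ?_, fun h => ?_⟩⟩
  · obtain ⟨z, hz, hyz⟩ := exists_lt_of_lt_csSup ⟨0, mem_insert _ _⟩ h
    rcases hz with rfl | hz
    · exact absurd hyz (not_lt.2 hy.1.le)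
    · exact (hb hy hz.1 hyz).trans_le hz.2
  · by_contra! hle
    exact absurd (le_csSup hbdd (mem_insert_of_mem _ ⟨hy, hle⟩)) (not_le.2 h)

/-- A conull set is dense in `(0, vbar)`, so continuity gives weak inequalities against its points;
two of its points between `x` and `y` make the inequality strict. -/
theorem strictMonoOn_Ioo_of_conull {μ : Measure ℝ} {vbar : ℝ} (hμ : IsFullOn μ vbar) {A : Set ℝ}
    (hA : ∀ᵐ v ∂μ, v ∈ A) {c : ℝ → ℝ} (hc : ContinuousOn c (Ioo 0 vbar)) (hcA : StrictMonoOn c A) :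
    StrictMonoOn c (Ioo 0 vbar) := by
  have hat : ∀ x ∈ Ioo 0 vbar, ContinuousAt c x := fun x hx =>
    hc.continuousAt (isOpen_Ioo.mem_nhds hx)
  have hleft : ∀ x ∈ Ioo 0 vbar, ∀ z ∈ A, x < z → c x ≤ c z := by
    intro x hx z hz hxz
    by_contra! hlt
    obtain ⟨δ, hδ, H⟩ := Metric.eventually_nhds_iff.1 ((hat x hx).eventually (lt_mem_nhds hlt))
    obtain ⟨y, hy, hxy, hym⟩ := hμ.exists_mem hA (a := x) (c := min (min (x + δ) z) vbar) hx.1.le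
      (lt_min (lt_min (by linarith) hxz) hx.2) (min_le_right _ _)
    have h1 : y < x + δ := hym.trans_le ((min_le_left _ _).trans (min_le_left _ _))
    have h2 : y < z := hym.trans_le ((min_le_left _ _).trans (min_le_right _ _))
    have h3 := H (y := y) (by rw [Real.dist_eq, abs_lt]; constructor <;> linarith)
    exact absurd (hcA hy hz h2) h3.not_gt
  have hright : ∀ x ∈ Ioo 0 vbar, ∀ z ∈ A, z < x → c z ≤ c x := by
    intro x hx z hz hxz
    by_contra! hlt
    obtain ⟨δ, hδ, H⟩ := Metric.eventually_nhds_iff.1 ((hat x hx).eventually (gt_mem_nhds hlt))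
    obtain ⟨y, hy, hym, hyx⟩ := hμ.exists_mem hA (a := max (max (x - δ) z) 0) (c := x)
      (le_max_right _ _) (max_lt (max_lt (by linarith) hxz) hx.1) hx.2.le
    have h1 : x - δ < y := ((le_max_left _ _).trans (le_max_left _ _)).trans_lt hym
    have h2 : z < y := ((le_max_right _ _).trans (le_max_left _ _)).trans_lt hym
    have h3 := H (y := y) (by rw [Real.dist_eq, abs_lt]; constructor <;> linarith)
    exact absurd (hcA hz hy h2) h3.not_gt
  intro x hx y hy hxy
  obtain ⟨z, hz, hxz, hzy⟩ := hμ.exists_mem hA hx.1.le hxy hy.2.le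
  obtain ⟨z', hz', hzz', hz'y⟩ := hμ.exists_mem hA (hx.1.trans hxz).le hzy hy.2.le
  exact (hleft x hx z hz hxz).trans_lt ((hcA hz hz' hzz').trans_le (hright y hy z' hz' hz'y))

section Existence

variable {n k : ℕ} {μ : Measure ℝ} {vbar : ℝ} {α β : Fin k → ℝ}

theorem quantileBid_pos [IsProbabilityMeasure μ]
    (hk : 0 < k) (hkn : k < n) (hα : Antitone α) (hα0 : ∀ j, 0 < α j)
    (hβ : Antitone β) (hβ0 : ∀ j, 0 < β j) (hμ : IsFullOn μ vbar) {v : ℝ} (hv : v ∈ Ioo 0 vbar) :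
    0 < quantileBid μ n α β v :=
  mul_pos hv.1 (div_pos (marginal_pos hk hkn hβ hβ0 (hμ.cdf_pos hv) (hμ.cdf_lt_one hv))
    (marginal_pos hk hkn hα hα0 (hμ.cdf_pos hv) (hμ.cdf_lt_one hv)))

theorem continuousOn_quantileBid [IsProbabilityMeasure μ] [NullSingletonClass μ]
    (hk : 0 < k) (hkn : k < n) (hα : Antitone α)
    (hα0 : ∀ j, 0 < α j) (hμ : IsFullOn μ vbar) :
    ContinuousOn (quantileBid μ n α β) (Ioo 0 vbar) := by
  have hcont : ∀ γ : Fin k → ℝ, Continuous fun y => marginal n γ (cdf μ y) := fun γ =>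
    (continuous_marginal n γ).comp (continuous_cdf μ)
  exact continuousOn_id.mul ((hcont β).continuousOn.div (hcont α).continuousOn fun v hv =>
    (marginal_pos hk hkn hα hα0 (hμ.cdf_pos hv) (hμ.cdf_lt_one hv)).ne')

/-- If the other agents bid almost surely as prescribed by `quantileBid`, then the best bid of an
agent with value `v` is one that separates the others like `v` does. -/
theorem expectedUtility_le_of_isThreshold [IsProbabilityMeasure μ] [NullSingletonClass μ]
    (hk : 0 < k) (hkn : k < n) (hα : Antitone α)
    (hα0 : ∀ j, 0 < α j) (hβ : Antitone β) (hβ0 : ∀ j, 0 < β j) (hμ : IsFullOn μ vbar)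
    {g : (Fin n → ℝ) → Equiv.Perm (Fin n)} (hg : IsAllocationRule g) {b : ℝ → ℝ}
    (hbm : Measurable b) (hb : StrictMonoOn b (Ioo 0 vbar))
    (hbq : ∀ v ∈ Ioo 0 vbar, b v = quantileBid μ n α β v) {B : Fin n → ℝ → ℝ}
    (hB : ∀ l, B l =ᵐ[μ] b) (i : Fin n) {v xv : ℝ} (hv : IsThreshold (Ioo 0 vbar) b xv v)
    (x : ℝ) : expectedUtility μ α β g B i x v ≤ expectedUtility μ α β g B i xv v := by
  have hb0 : ∀ v ∈ Ioo 0 vbar, 0 ≤ b v := fun v hv => by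
    rw [hbq v hv]; exact (quantileBid_pos hk hkn hα hα0 hβ hβ0 hμ hv).le
  set φ : ℝ → ℝ := fun y => (v - y) * marginal n β (cdf μ y) with hφ
  have hMβ : ∀ y, 0 ≤ marginal n β (cdf μ y) := fun y =>
    marginal_nonneg n hβ hβ0 (cdf_nonneg μ y) (cdf_le_one μ y)
  have key : ∀ x t, IsThreshold (Ioo 0 vbar) b x t → IntegrableOn φ (Iio t) μ ∧
      expectedUtility μ α β g B i x v = ∫ y in Iio t, φ y ∂μ := by
    intro x t ht
    have hbi := ht.integrableOn hμ.ae_mem hbm hb0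
    have h1 : IntegrableOn (fun y => v * marginal n β (cdf μ y)) (Iio t) μ :=
      (integrableOn_marginal_cdf β _).const_mul v
    have h2 := integrableOn_mul_marginal hbi n α
    have hae : (fun y => v * marginal n β (cdf μ y) - b y * marginal n α (cdf μ y))
        =ᵐ[μ.restrict (Iio t)] φ := by
      filter_upwards [ae_restrict_of_ae hμ.ae_mem] with y hy
      have hM := marginal_pos hk hkn hα hα0 (hμ.cdf_pos hy) (hμ.cdf_lt_one hy)
      rw [hbq y hy, quantileBid, mul_assoc, div_mul_cancel₀ _ hM.ne', hφ]
      ring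
    refine ⟨(h1.sub h2).congr hae, ?_⟩
    rw [(expectedPayment_and_expectedUtility hkn μ α β hg hμ.ae_mem hbm hb hb0 hB i ht).2 v,
      ← integral_const_mul, ← integral_sub h1 h2]
    exact integral_congr_ae hae
  obtain ⟨t, ht⟩ := exists_isThreshold hb x
  obtain ⟨ht1, ht2⟩ := key x t ht
  obtain ⟨hv1, hv2⟩ := key xv v hv
  rw [ht2, hv2, ← integral_indicator measurableSet_Iio, ← integral_indicator measurableSet_Iio]
  refine integral_mono (ht1.integrable_indicator measurableSet_Iio)
    (hv1.integrable_indicator measurableSet_Iio) fun y => ?_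
  -- `φ` is nonnegative below `v` and nonpositive above, so no half-line gives a larger integral
  -- than `Iio v`.
  rcases lt_or_ge y v with hyv | hyv
  · have h0 : 0 ≤ φ y := mul_nonneg (by linarith) (hMβ y)
    rw [indicator_of_mem (mem_Iio.2 hyv)]
    exact indicator_le_self' (fun _ _ => h0) y
  · have h0 : φ y ≤ 0 := mul_nonpos_of_nonpos_of_nonneg (by linarith) (hMβ y)
    rw [indicator_of_notMem (s := Iio v) (by simpa using hyv)]
    exact indicator_apply_le' (fun _ => h0) fun _ => le_rfl

/-- The version of the candidate bidding function without exceptional values. -/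
def regularBid (μ : Measure ℝ) (n : ℕ) (α β : Fin k → ℝ) (vbar v : ℝ) : ℝ :=
  if v = vbar then sSup (quantileBid μ n α β '' Ioo 0 vbar) else quantileBid μ n α β v

theorem regularBid_of_ne {v : ℝ} (hv : v ≠ vbar) :
    regularBid μ n α β vbar v = quantileBid μ n α β v := if_neg hv

theorem measurable_regularBid : Measurable (regularBid μ n α β vbar) := by
  have hM : ∀ γ : Fin k → ℝ, Measurable fun y => marginal n γ (cdf μ y) := fun γ =>
    (continuous_marginal n γ).measurable.comp (cdf μ).mono.measurable
  exact Measurable.ite (measurableSet_singleton vbar) measurable_const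
    (measurable_id.mul ((hM β).div (hM α)))

theorem strictMonoOn_regularBid_Ico [IsProbabilityMeasure μ]
    (hk : 0 < k) (hkn : k < n) (hα : Antitone α)
    (hα0 : ∀ j, 0 < α j) (hβ : Antitone β) (hβ0 : ∀ j, 0 < β j) (hμ : IsFullOn μ vbar)
    (hq : StrictMonoOn (quantileBid μ n α β) (Ioo 0 vbar)) :
    StrictMonoOn (regularBid μ n α β vbar) (Ico 0 vbar) := by
  intro x hx y hy hxy
  rw [regularBid_of_ne hx.2.ne, regularBid_of_ne hy.2.ne]
  have hy' : y ∈ Ioo 0 vbar := ⟨hx.1.trans_lt hxy, hy.2⟩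
  -- At `0` the factor `v` makes the bid zero, whatever the quotient of marginals.
  rcases hx.1.eq_or_lt with rfl | hx0
  · have := quantileBid_pos hk hkn hα hα0 hβ hβ0 hμ hy'
    simpa [quantileBid] using this
  · exact hq ⟨hx0, hx.2⟩ hy' hxy

/-- The bound makes `sSup` a genuine supremum rather than the default `0`; a midpoint below `vbar`
gives strictness there. -/
theorem strictMonoOn_regularBid_Icc [IsProbabilityMeasure μ]
    (hk : 0 < k) (hkn : k < n)
    (hα : Antitone α) (hα0 : ∀ j, 0 < α j) (hβ : Antitone β) (hβ0 : ∀ j, 0 < β j)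
    (hμ : IsFullOn μ vbar) (hq : StrictMonoOn (quantileBid μ n α β) (Ioo 0 vbar))
    (hbdd : BddAbove (quantileBid μ n α β '' Ioo 0 vbar)) :
    StrictMonoOn (regularBid μ n α β vbar) (Icc 0 vbar) := by
  have hIco := strictMonoOn_regularBid_Ico hk hkn hα hα0 hβ hβ0 hμ hq
  intro x hx y hy hxy
  rcases hy.2.eq_or_lt with rfl | hyv
  · have hz : (x + y) / 2 ∈ Ioo 0 y := ⟨by linarith [hx.1], by linarith⟩
    have h1 := hIco ⟨hx.1, hxy⟩ ⟨hz.1.le, hz.2⟩ (by linarith : x < (x + y) / 2)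
    refine h1.trans_le ?_
    rw [regularBid_of_ne hz.2.ne, regularBid, if_pos rfl]
    exact le_csSup hbdd (mem_image_of_mem _ hz)
  · exact hIco ⟨hx.1, hxy.trans hyv⟩ ⟨hy.1, hyv⟩ hxy

theorem isEfficientEquilibriumOn_regularBid [IsProbabilityMeasure μ] [NullSingletonClass μ]
    (hk : 0 < k) (hkn : k < n) (hα : Antitone α)
    (hα0 : ∀ j, 0 < α j) (hβ : Antitone β) (hβ0 : ∀ j, 0 < β j) (hμ : IsFullOn μ vbar)
    {g : (Fin n → ℝ) → Equiv.Perm (Fin n)} (hg : IsAllocationRule g) {T : Set ℝ}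
    (hIT : Ico 0 vbar ⊆ T) (hT0 : ∀ v ∈ T, 0 ≤ v) (h0 : 0 ∈ T)
    (hT : StrictMonoOn (regularBid μ n α β vbar) T) (hvbar : 0 < vbar) :
    IsEfficientEquilibriumOn T μ α β g (regularBid μ n α β vbar) where
  measurable := measurable_regularBid
  nonneg := by
    intro v hv
    have h := hT.monotoneOn h0 hv (hT0 v hv)
    rw [regularBid_of_ne hvbar.ne] at h
    simpa [quantileBid] using h
  efficient := fun v hv => isEfficient_of_strictMonoOn hβ hβ0 hg hT hv
  best_response := by
    intro i v hv x _
    have hsub : Ioo 0 vbar ⊆ T := Ioo_subset_Ico_self.trans hIT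
    exact expectedUtility_le_of_isThreshold hk hkn hα hα0 hβ hβ0 hμ hg measurable_regularBid
      (hT.mono hsub) (fun v hv => regularBid_of_ne hv.2.ne) (fun _ => Filter.EventuallyEq.rfl) i
      (isThreshold_of_strictMonoOn hT hsub hv) x

end Existence

/-! ### Transfer to the candidate bid and conclusion -/

section Main

variable {n k : ℕ} {μ : Measure ℝ} [IsProbabilityMeasure μ] [NullSingletonClass μ] {vbar : ℝ}
  {α β : Fin k → ℝ} {g : (Fin n → ℝ) → Equiv.Perm (Fin n)}

theorem strictMonoOn_quantileBid (hk : 0 < k) (hkn : k < n) (hα : Antitone α)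
    (hα0 : ∀ j, 0 < α j) (hμ : IsFullOn μ vbar)
    (hcq : candidateBid μ n α β =ᵐ[μ] quantileBid μ n α β)
    (hinc : IncreasingAE μ (candidateBid μ n α β)) :
    StrictMonoOn (quantileBid μ n α β) (Ioo 0 vbar) := by
  obtain ⟨N, hN, hmono⟩ := hinc
  refine strictMonoOn_Ioo_of_conull hμ
    (A := {v | v ∈ Nᶜ ∧ candidateBid μ n α β v = quantileBid μ n α β v}) ?_
    (continuousOn_quantileBid hk hkn hα hα0 hμ) ?_
  · filter_upwards [measure_eq_zero_iff_ae_notMem.1 hN, hcq] with v h1 h2 using ⟨h1, h2⟩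
  · intro x hx y hy hxy
    rw [← hx.2, ← hy.2]
    exact hmono hx.1 hy.1 hxy

theorem isEfficientEquilibrium_candidateBid (hk : 0 < k) (hkn : k < n) (hα : Antitone α)
    (hα0 : ∀ j, 0 < α j) (hβ : Antitone β) (hβ0 : ∀ j, 0 < β j) (hμ : IsFullOn μ vbar)
    (hg : IsAllocationRule g) (hcq : candidateBid μ n α β =ᵐ[μ] quantileBid μ n α β)
    (hq : StrictMonoOn (quantileBid μ n α β) (Ioo 0 vbar)) :
    IsEfficientEquilibrium μ α β g (fun _ => candidateBid μ n α β) where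
  measurable := fun _ => measurable_candidateBid μ n α β
  nonneg := by
    intro _
    filter_upwards [hcq, hμ.ae_mem] with v h1 h2
    rw [h1]
    exact (quantileBid_pos hk hkn hα hα0 hβ hβ0 hμ h2).le
  efficient := by
    filter_upwards [ae_pi_of_ae fun _ : Fin n => hμ.ae_mem.and hcq] with v hv
    have : (fun i => candidateBid μ n α β (v i)) = fun i => quantileBid μ n α β (v i) :=
      funext fun i => (hv i).2
    rw [this]
    exact isEfficient_of_strictMonoOn hβ hβ0 hg hq fun i => (hv i).1
  best_response := by
    intro i
    have hr : ∀ v ∈ Ioo 0 vbar, regularBid μ n α β vbar v = quantileBid μ n α β v :=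
      fun v hv => regularBid_of_ne hv.2.ne
    have hrm : StrictMonoOn (regularBid μ n α β vbar) (Ioo 0 vbar) := hq.congr fun v hv =>
      (hr v hv).symm
    have hcr : candidateBid μ n α β =ᵐ[μ] regularBid μ n α β vbar := by
      filter_upwards [hcq, hμ.ae_mem] with v h1 h2
      rw [h1, hr v h2]
    filter_upwards [hcr, hμ.ae_mem] with v h1 h2 x _
    refine expectedUtility_le_of_isThreshold hk hkn hα hα0 hβ hβ0 hμ hg measurable_regularBid hrm
      hr (fun _ => hcr) i ?_ x
    rw [h1]
    exact isThreshold_of_strictMonoOn hrm subset_rfl h2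

theorem ae_expectedPayment_eq {f : ℝ → ℝ} (hf : Measurable f) (hf0 : ∀ v, 0 ≤ f v)
    (hμf : μ = volume.withDensity fun v => ENNReal.ofReal (f v)) (hkn : k < n)
    (hμ : IsFullOn μ vbar) (hg : IsAllocationRule g) {b : ℝ → ℝ} (hbm : Measurable b)
    (hb0 : ∀ᵐ v ∂μ, 0 ≤ b v) (hb : IncreasingAE μ b) (i : Fin n) :
    ∀ᵐ v ∂μ,
      (∀ s : Fin k, IntervalIntegrable (fun t => deriv (posProb μ n s) t * b t) volume 0 v) ∧
      expectedPayment μ α g (fun _ => b) i (b v) =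
        ∑ s : Fin k, α s * ∫ t in (0 : ℝ)..v, deriv (posProb μ n s) t * b t := by
  obtain ⟨N, hN, hmono⟩ := hb
  set A : Set ℝ := {v | v ∈ Nᶜ ∧ 0 ≤ b v} with hAdef
  have hA : ∀ᵐ v ∂μ, v ∈ A := by
    filter_upwards [measure_eq_zero_iff_ae_notMem.1 hN, hb0] with v h1 h2 using ⟨h1, h2⟩
  have hbA : StrictMonoOn b A := hmono.mono fun v hv => hv.1
  filter_upwards [hA, hμ.ae_mem] with v hv hvI
  have ht : IsThreshold A b (b v) v := isThreshold_of_strictMonoOn hbA subset_rfl hv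
  obtain ⟨h1, h2⟩ := integral_mul_marginal_eq hf hf0 hμf (hμ.ae_mem.mono fun _ h => h.1) hvI.1.le
    (ht.integrableOn hA hbm fun _ h => h.2) n α
  refine ⟨h1, ?_⟩
  -- Payments do not involve `β`, so `α` fills its place.
  rw [(expectedPayment_and_expectedUtility hkn μ α α hg hA hbm hbA (fun _ h => h.2)
    (fun _ => Filter.EventuallyEq.rfl) i ht).1, h2]

end Main

end PositionAuction

end

open PositionAuction in
theorem lemma6 (n k : ℕ) (hk : 0 < k) (hkn : k < n)
    (α β : Fin k → ℝ) (hα : Antitone α) (hα0 : ∀ j, 0 < α j) (hβ : Antitone β) (hβ0 : ∀ j, 0 < β j)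
    (vbar : ℝ) (hvbar : 0 < vbar)
    (μ : Measure ℝ) [IsProbabilityMeasure μ]
    (f : ℝ → ℝ) (hf : Measurable f) (hf0 : ∀ v, 0 ≤ f v)
    (hμf : μ = volume.withDensity fun v => ENNReal.ofReal (f v))
    (hsupp : μ.support = Icc 0 vbar)
    (g : (Fin n → ℝ) → Equiv.Perm (Fin n)) (hg : IsAllocationRule g) :
    -- every efficient equilibrium uses the candidate bidding function
    (∀ b : Fin n → ℝ → ℝ, IsEfficientEquilibrium μ α β g b →
      ∀ i, b i =ᵐ[μ] candidateBid μ n α β) ∧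
    -- if the candidate is increasing, then it is an efficient equilibrium
    (IncreasingAE μ (candidateBid μ n α β) →
      IsEfficientEquilibrium μ α β g (fun _ => candidateBid μ n α β) ∧
      -- and it has a version without exceptional values, except possibly at `vbar`
      ∃ b : ℝ → ℝ, b =ᵐ[μ] candidateBid μ n α β ∧
        IsEfficientEquilibriumOn (Ico 0 vbar) μ α β g b ∧
        ((∃ C, ∀ᵐ v ∂μ, candidateBid μ n α β v ≤ C) →
          IsEfficientEquilibriumOn (Icc 0 vbar) μ α β g b)) ∧
    -- otherwise there is no efficient equilibrium
    (¬ IncreasingAE μ (candidateBid μ n α β) →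
      ¬ ∃ b : Fin n → ℝ → ℝ, IsEfficientEquilibrium μ α β g b) ∧
    -- the expected payment under a symmetric increasing profile of bidding functions
    (∀ b : ℝ → ℝ, Measurable b → (∀ᵐ v ∂μ, 0 ≤ b v) → IncreasingAE μ b →
      ∀ i, ∀ᵐ v ∂μ,
        (∀ s : Fin k, IntervalIntegrable (fun t => deriv (posProb μ n s) t * b t) volume 0 v) ∧
        expectedPayment μ α g (fun _ => b) i (b v) =
          ∑ s : Fin k, α s * ∫ t in (0 : ℝ)..v, deriv (posProb μ n s) t * b t) := by
  have : NullSingletonClass μ := nullSingletonClass_of_withDensity hμf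
  have hμ : IsFullOn μ vbar := isFullOn_of_support hsupp
  have hcq := candidateBid_ae_eq hf hf0 hμf n α β
  refine ⟨fun b hb i => ?_, fun hinc => ?_, fun hinc => ?_, fun b hbm hb0 hb i =>
    ae_expectedPayment_eq hf hf0 hμf hkn hμ hg hbm hb0 hb i⟩
  · exact (hb.ae_eq_quantileBid hk hkn hα hα0 hβ0 hμ hg i).1.trans hcq.symm
  · have hq := strictMonoOn_quantileBid hk hkn hα hα0 hμ hcq hinc
    refine ⟨isEfficientEquilibrium_candidateBid hk hkn hα hα0 hβ hβ0 hμ hg hcq hq,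
      regularBid μ n α β vbar, ?_, ?_, ?_⟩
    · filter_upwards [hcq, hμ.ae_mem] with v h1 h2
      rw [h1, regularBid_of_ne h2.2.ne]
    · exact isEfficientEquilibriumOn_regularBid hk hkn hα hα0 hβ hβ0 hμ hg subset_rfl
        (fun v hv => hv.1) ⟨le_rfl, hvbar⟩
        (strictMonoOn_regularBid_Ico hk hkn hα hα0 hβ hβ0 hμ hq) hvbar
    · rintro ⟨C, hC⟩
      -- An essential bound is a bound everywhere on `(0, vbar)`: every `v` lies below some typical
      -- `z`, and `quantileBid` increases.
      have hbdd : BddAbove (quantileBid μ n α β '' Ioo 0 vbar) := by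
        refine ⟨C, ?_⟩
        rintro _ ⟨v, hv, rfl⟩
        obtain ⟨z, ⟨hzI, hzq, hzC⟩, hvz, -⟩ := hμ.exists_mem
          (A := {z | z ∈ Ioo 0 vbar ∧ candidateBid μ n α β z = quantileBid μ n α β z ∧
            candidateBid μ n α β z ≤ C})
          (by filter_upwards [hμ.ae_mem, hcq, hC] with z h1 h2 h3 using ⟨h1, h2, h3⟩)
          hv.1.le hv.2 le_rfl
        exact (hq hv hzI hvz).le.trans (hzq ▸ hzC)
      exact isEfficientEquilibriumOn_regularBid hk hkn hα hα0 hβ hβ0 hμ hg Ico_subset_Icc_self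
        (fun v hv => hv.1) ⟨le_rfl, hvbar.le⟩
        (strictMonoOn_regularBid_Icc hk hkn hα hα0 hβ hβ0 hμ hq hbdd) hvbar
  · rintro ⟨b, hb⟩
    obtain ⟨h1, A, hA, hmono⟩ :=
      hb.ae_eq_quantileBid hk hkn hα hα0 hβ0 hμ hg (⟨0, by omega⟩ : Fin n)
    refine hinc ⟨{v | v ∈ A ∧ candidateBid μ n α β v = b ⟨0, by omega⟩ v}ᶜ, ?_, ?_⟩
    · rw [measure_eq_zero_iff_ae_notMem]
      filter_upwards [hA, h1, hcq] with v h2 h3 h4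
      exact notMem_compl_iff.2 ⟨h2, h4.trans h3.symm⟩
    · rw [compl_compl]
      intro x hx y hy hxy
      rw [hx.2, hy.2]
      exact hmono hx.1 hy.1 hxy
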